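/- Let $\mathbb{F}_q$ be a finite field, $G=\mathbb{F}_q^+$, with supercharacters $\{\mathbb 1,\mathrm{reg}-\mathbb 1\}$ and superclasses $\{0\}$, $G\setminus\{0\}$. For $k\ge 0$ give $G^k$ the product supercharacter theory (supercharacters are products of supercharacters of $G$, superclasses are products of superclasses), and let $\mathrm{scf}(\cdot)$ denote the space of complex functions constant on superclasses. Put $\mathrm{scf}(G^{0-1})=\mathbb{C}\chi^\emptyset$ and $$\mathcal H=\mathcal H_{(\mathbb 1,\mathrm{reg},\mathrm{reg})}=\bigoplus_{n\ge 0}\mathrm{scf}(G^{n-1}).$$ Its unit is $\chi^\emptyset$ and its counit is the projection to degree $0$. For $m,n\ge1$ the product of $\psi\in\mathrm{scf}(G^{m-1})$ and $\gamma\in\mathrm{scf}(G^{n-1})$ is the function $(g_1,\dots,g_{m+n-1})\mapsto\psi(g_1,\dots,g_{m-1})\,\gamma(g_{m+1},\dots,g_{m+n-1})$. The coproduct of $\psi\in\mathrm{scf}(G^{n-1})$ is the sum over $A\subseteq\{1,\dots,n\}$ of the elements of $\mathrm{scf}(G^{|A|-1})\otimes\mathrm{scf}(G^{|A^c|-1})$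 given by the functions $(g',g'')\mapsto\psi(h)$. Here $h_j=g'_i$ if $j$ and $j+1$ are the $i$-th and $(i+1)$-st elements of $A$, $h_j=g''_i$ if they are the $i$-th and $(i+1)$-st elements of $A^c$, and $h_j=0$ if they are not in the same one of the two sets. Let $\mathrm{UT}_n$ be the group of unipotent upper triangular $n\times n$ matrices over $\mathbb{F}_q$, $B_n$ the group of invertible upper triangular matrices and $\mathfrak{ut}_n$ the additive group of strictly upper triangular matrices. The superclasses of $\mathrm{UT}_n$ are the classes of the relation "$u-1=x(v-1)y$ for some $x,y\in B_n$". Both $B_n$ and $\mathrm{UT}_n$ act on the left and on the right on the characters of $\mathfrak{ut}_n$ through the maps $a\mapsto xay$. The supercharacters of $\mathrm{UT}_n$ are the functions $$\chi^\theta(u)=\frac{|\theta\,\mathrm{UT}_n|}{|\mathrm{UT}_n\,\theta\,\mathrm{UT}_n|}\sum_{\mu\in B_n\theta B_n}\mu(u-1),$$ for characters $\theta$ of $\mathfrak{ut}_n$. Let $\mathrm{scf}(\mathrm{UT}_\bullet)=\bigoplus_{n\ge0}\mathrm{scf}(\mathrm{UT}_n)$, with unit the constant function $1$ in degree $0$ and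 counit the projection to degree $0$. Its product is $(\psi\gamma)(u)=\psi(u')\gamma(u'')$, where $u'\in\mathrm{UT}_m$ and $u''\in\mathrm{UT}_n$ are the diagonal blocks of $u\in\mathrm{UT}_{m+n}$. The coproduct of $\psi\in\mathrm{scf}(\mathrm{UT}_n)$ is the sum over $A\subseteq\{1,\dots,n\}$ of the restrictions of $\psi$ to the subgroup $\mathrm{UT}_{|A|}\times\mathrm{UT}_{|A^c|}$ of matrices whose nonzero entries off the diagonal lie in positions $(i,j)$ with $i,j\in A$ or $i,j\in A^c$. Then $\mathcal H$ and $\mathrm{scf}(\mathrm{UT}_\bullet)$ are Hopf algebras, and the first superdiagonal induces an isomorphism $\mathrm{UT}_n/[\mathrm{UT}_n,\mathrm{UT}_n]\cong G^{n-1}$ for $n\ge1$. Extending linearly the inflation maps $\mathrm{scf}(G^{n-1})\to\mathrm{scf}(\mathrm{UT}_n)$ along $\mathrm{UT}_n\to\mathrm{UT}_n/[\mathrm{UT}_n,\mathrm{UT}_n]\cong G^{n-1}$ (and $\chi^\emptyset\mapsto1$ in degree $0$) gives an injective morphism of Hopf algebras $\mathcal H\to\mathrm{scf}(\mathrm{UT}_\bullet)$.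 For each $n$, the images of the supercharacters in degree $n$ are exactly the supercharacters of $\mathrm{UT}_n$ that contain a linear (degree one) character as a constituent. -/

import Mathlib

open scoped TensorProduct DirectSum

noncomputable section

namespace TowerHopf

/-! ### Hopf algebras -/

/-- An algebra with a given comultiplication and counit is a Hopf algebra: the comultiplication is
coassociative and counital, comultiplication and counit are algebra homomorphisms, and there is an
antipode. (These are the axioms of `HopfAlgebra`, as a property of given operations.) -/
structure IsHopf (A : Type*) [Semiring A] [Algebra ℂ A] [co : CoalgebraStruct ℂ A] : Prop where
  isCoalgebra : ∃ c : Coalgebra ℂ A, c.toCoalgebraStruct = co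
  counit_one : CoalgebraStruct.counit (R := ℂ) (1 : A) = 1
  counit_mul : ∀ a b : A, CoalgebraStruct.counit (R := ℂ) (a * b)
    = CoalgebraStruct.counit (R := ℂ) a * CoalgebraStruct.counit (R := ℂ) b
  comul_one : CoalgebraStruct.comul (R := ℂ) (1 : A) = 1
  comul_mul : ∀ a b : A, CoalgebraStruct.comul (R := ℂ) (a * b)
    = CoalgebraStruct.comul (R := ℂ) a * CoalgebraStruct.comul (R := ℂ) b
  antipode : ∃ S : A →ₗ[ℂ] A,
    LinearMap.mul' ℂ A ∘ₗ S.rTensor A ∘ₗ CoalgebraStruct.comul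
      = Algebra.linearMap ℂ A ∘ₗ CoalgebraStruct.counit ∧
    LinearMap.mul' ℂ A ∘ₗ S.lTensor A ∘ₗ CoalgebraStruct.comul
      = Algebra.linearMap ℂ A ∘ₗ CoalgebraStruct.counit

/-! ### Superclass functions -/

section Superclass

variable {X Y : Type*}

/-- The space of superclass functions: complex functions that are constant on the superclasses,
the superclasses being the equivalence classes of `r`. -/
def scf (r : Setoid X) : Submodule ℂ (X → ℂ) where
  carrier := {f | ∀ x y, r x y → f x = f y}
  add_mem' := by
    intro f g hf hg x y h
    simp [hf x y h, hg x y h]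
  zero_mem' := by
    intro x y _
    rfl
  smul_mem' := by
    intro c f hf x y h
    simp [hf x y h]

/-- The constant function `1`, i.e. the trivial character. -/
def scf.one (r : Setoid X) : scf r := ⟨fun _ => 1, fun _ _ _ => rfl⟩

open Classical in
/-- The superclass identifier function of the superclass `S`. -/
def scf.delta {r : Setoid X} (S : Quotient r) : scf r :=
  ⟨fun x => if (⟦x⟧ : Quotient r) = S then 1 else 0, by
    intro x y h
    have : (⟦x⟧ : Quotient r) = ⟦y⟧ := Quotient.sound h
    simp only [this]⟩

/-- The identification of superclass functions on a product `X × Y` (superclasses being products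
of superclasses) with the tensor product of the spaces of superclass functions, written
in the bases of superclass identifier functions. -/
def scf.toTensor [Finite X] [Finite Y] (r : Setoid X) (s : Setoid Y) :
    scf (r.prod s) →ₗ[ℂ] scf r ⊗[ℂ] scf s :=
  letI := Fintype.ofFinite (Quotient r)
  letI := Fintype.ofFinite (Quotient s)
  { toFun := fun f => ∑ S : Quotient r, ∑ T : Quotient s,
      f.1 (S.out, T.out) • (scf.delta S ⊗ₜ[ℂ] scf.delta T)
    map_add' := by
      intro f g
      simp [add_smul, Finset.sum_add_distrib]
    map_smul' := by
      intro c f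
      simp [mul_smul, Finset.smul_sum] }

/-- Evaluation of a tensor at a point of `X × Y`: `f ⊗ g` has the value `f x * g y`. -/
def scf.evalTensor (r : Setoid X) (s : Setoid Y) (x : X) (y : Y) :
    scf r ⊗[ℂ] scf s →ₗ[ℂ] ℂ :=
  LinearMap.mul' ℂ ℂ ∘ₗ TensorProduct.map
    (LinearMap.proj x ∘ₗ (scf r).subtype) (LinearMap.proj y ∘ₗ (scf s).subtype)

/-- `scf.toTensor f` is the tensor which, as a function on `X × Y`, is `f`. -/
theorem scf.evalTensor_toTensor [Finite X] [Finite Y] (r : Setoid X) (s : Setoid Y)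
    (f : scf (r.prod s)) (x : X) (y : Y) :
    scf.evalTensor r s x y (scf.toTensor r s f) = f.1 (x, y) := by
  classical
  let := Fintype.ofFinite (Quotient r)
  let := Fintype.ofFinite (Quotient s)
  have h : ∀ (S : Quotient r) (T : Quotient s),
      scf.evalTensor r s x y (scf.delta S ⊗ₜ[ℂ] scf.delta T)
        = (if (⟦x⟧ : Quotient r) = S then 1 else 0) * (if (⟦y⟧ : Quotient s) = T then 1 else 0) := by
    intro S T
    simp [scf.evalTensor, scf.delta]
  simp only [scf.toTensor, LinearMap.coe_mk, AddHom.coe_mk, map_sum, map_smul, h]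
  simp only [smul_eq_mul, mul_ite, mul_one, mul_zero, Finset.sum_ite_eq, Finset.mem_univ, if_true]
  refine f.2 _ _ ⟨?_, ?_⟩
  · exact Quotient.mk_out (s := r) x
  · exact Quotient.mk_out (s := s) y

end Superclass

/-! ### The Hopf algebras attached to the tower `G^{n-1}` -/

section GroupTower

variable {G : Type*}

/-- Products of superclasses of `G` are the superclasses of `G^k`. -/
def powSetoid (c : Setoid G) (k : ℕ) : Setoid (Fin k → G) where
  r g h := ∀ i, c (g i) (h i)
  iseqv := ⟨fun g i => c.refl' (g i), fun h i => c.symm' (h i),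
    fun h h' i => c.trans' (h i) (h' i)⟩

/-- The supercharacters of `G^k`: products of supercharacters of `G`. -/
def powCh {c : Setoid G} (Ch : Set (scf c)) (k : ℕ) : Set (scf (powSetoid c k)) :=
  {f | ∃ χ : Fin k → scf c, (∀ i, χ i ∈ Ch) ∧ ∀ g, f.1 g = ∏ i, (χ i).1 (g i)}

/-- The superclasses `{1}` and `G - {1}`. -/
def trivialCl (G : Type*) [Group G] : Setoid G where
  r x y := x = 1 ↔ y = 1
  iseqv := ⟨fun _ => Iff.rfl, fun h => h.symm, fun h h' => h.trans h'⟩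

open Classical in
/-- The regular character of `G`. -/
def reg (G : Type*) [Group G] [Fintype G] : scf (trivialCl G) :=
  ⟨fun g => if g = 1 then (Fintype.card G : ℂ) else 0, by
    intro x y h
    have h' : x = 1 ↔ y = 1 := h
    simp only [h']⟩

/-- The supercharacters `1` and `reg - 1`. -/
def trivialCh (G : Type*) [Group G] [Fintype G] : Set (scf (trivialCl G)) :=
  {scf.one _, reg G - scf.one _}

/-- The degree `n` component `scf(G^{n-1})`. For `n = 0` this is, like for `n = 1`, a
one-dimensional space (functions on a one-point set). The parameter `ι` enters only in the
product. -/
def Piece {c : Setoid G} (_ι : scf c) (n : ℕ) : Type _ := scf (powSetoid c (n - 1))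

instance {c : Setoid G} (ι : scf c) (n : ℕ) : AddCommGroup (Piece ι n) :=
  inferInstanceAs (AddCommGroup (scf (powSetoid c (n - 1))))

instance {c : Setoid G} (ι : scf c) (n : ℕ) : Module ℂ (Piece ι n) :=
  inferInstanceAs (Module ℂ (scf (powSetoid c (n - 1))))

/-- The product in degrees `m`, `n`: for `m, n ≥ 1` it sends `ψ ⊗ γ` to the function
`g ↦ ψ(g_1, …, g_{m-1}) ι(g_m) γ(g_{m+1}, …, g_{m+n-1})`; if `m = 0` or `n = 0` there is no
coordinate for `ι`, and it is multiplication by a scalar. -/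
def mulPiece {c : Setoid G} (ι : scf c) {m n : ℕ} (ψ : Piece ι m) (γ : Piece ι n) :
    Piece ι (m + n) :=
  ⟨fun g => ψ.1 (fun i => g ⟨i, by omega⟩)
      * (∏ k : Fin (m + n - 1), if k.val + 1 = m then ι.1 (g k) else 1)
      * γ.1 (fun j => g ⟨m + j, by omega⟩), by
    intro g h hgh
    dsimp only
    congr 1
    · congr 1
      · exact ψ.2 _ _ fun i => hgh _
      · refine Finset.prod_congr rfl fun k _ => ?_
        rw [ι.2 _ _ (hgh k)]
    · exact γ.2 _ _ fun i => hgh _⟩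

theorem piece_ext [One G] {c : Setoid G} {ι : scf c} {n n' : ℕ} (h : n = n')
    (f : Piece ι n) (f' : Piece ι n')
    (H : ∀ g : ℕ → G, f.1 (fun i => g i) = f'.1 (fun i => g i)) :
    GradedMonoid.mk n f = GradedMonoid.mk n' f' := by
  subst h
  congr 1
  apply Subtype.ext
  funext g
  have := H (fun i => if h : i < n - 1 then g ⟨i, h⟩ else 1)
  simpa using this

theorem prod_single (N m : ℕ) (φ : ℕ → ℂ) :
    (∏ k : Fin N, if k.val + 1 = m then φ k else 1)
      = if 1 ≤ m ∧ m ≤ N then φ (m - 1) else 1 := by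
  rw [Fin.prod_univ_eq_prod_range (fun k => if k + 1 = m then φ k else 1) N]
  split_ifs with h
  · rw [Finset.prod_eq_single (m - 1)]
    · rw [if_pos (by omega)]
    · intro b _ hb
      rw [if_neg (by omega)]
    · intro hm
      exact absurd (Finset.mem_range.mpr (by omega)) hm
  · refine Finset.prod_eq_one fun k hk => ?_
    rw [if_neg]
    have := Finset.mem_range.mp hk
    omega

theorem mulPiece_apply {c : Setoid G} (ι : scf c) {m n : ℕ} (ψ : Piece ι m) (γ : Piece ι n)
    (g : ℕ → G) :
    (mulPiece ι ψ γ).1 (fun i => g i) = ψ.1 (fun i => g i)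
      * (if 1 ≤ m ∧ m ≤ m + n - 1 then ι.1 (g (m - 1)) else 1) * γ.1 (fun j => g (m + j)) := by
  rw [← prod_single (m + n - 1) m (fun k => ι.1 (g k))]
  rfl

/-- The scalar `z` times the unit `χ^∅` of degree `0`. -/
def scalarPiece {c : Setoid G} (ι : scf c) (z : ℂ) : Piece ι 0 :=
  (z • scf.one _ : scf (powSetoid c (0 - 1)))

theorem scalar_mul [One G] {c : Setoid G} (ι : scf c) (z : ℂ) {n : ℕ} (a : Piece ι n) :
    GradedMonoid.mk (0 + n) (mulPiece ι (scalarPiece ι z) a) = GradedMonoid.mk n (z • a) := by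
  refine piece_ext (zero_add n) _ _ fun g => ?_
  rw [mulPiece_apply, if_neg (by omega)]
  simp only [zero_add]
  change (z * 1) * 1 * _ = z * _
  ring

theorem mul_scalar [One G] {c : Setoid G} (ι : scf c) (z : ℂ) {n : ℕ} (a : Piece ι n) :
    GradedMonoid.mk (n + 0) (mulPiece ι a (scalarPiece ι z)) = GradedMonoid.mk n (z • a) := by
  refine piece_ext (add_zero n) _ _ fun g => ?_
  rw [mulPiece_apply, if_neg (by omega)]
  change _ * 1 * (z * 1) = z * _
  ring

instance {c : Setoid G} (ι : scf c) : GradedMonoid.GMul (Piece ι) := ⟨mulPiece ι⟩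

instance {c : Setoid G} (ι : scf c) : GradedMonoid.GOne (Piece ι) := ⟨scalarPiece ι 1⟩

instance [One G] {c : Setoid G} (ι : scf c) : GradedMonoid.GMonoid (Piece ι) where
  one_mul a := by
    obtain ⟨n, a⟩ := a
    refine (scalar_mul ι 1 a).trans ?_
    rw [one_smul]
    rfl
  mul_one a := by
    obtain ⟨n, a⟩ := a
    refine (mul_scalar ι 1 a).trans ?_
    rw [one_smul]
    rfl
  mul_assoc a b d := by
    refine piece_ext (add_assoc _ _ _) _ _ fun g => ?_
    obtain ⟨m, a⟩ := a
    obtain ⟨n, b⟩ := b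
    obtain ⟨p, d⟩ := d
    refine (mulPiece_apply ι (mulPiece ι a b) d g).trans
      (.trans ?_ (mulPiece_apply ι a (mulPiece ι b d) g).symm)
    rw [mulPiece_apply ι a b g, mulPiece_apply ι b d (fun k => g (m + k))]
    simp only [← add_assoc]
    rcases Nat.eq_zero_or_pos m with rfl | hm
    · simp only [zero_add, nonpos_iff_eq_zero, one_ne_zero, false_and, if_false, mul_one]
      ring
    rcases Nat.eq_zero_or_pos n with rfl | hn
    · rw [if_neg (show ¬(1 ≤ m ∧ m ≤ m + 0 - 1) by omega),
        if_neg (show ¬(1 ≤ 0 ∧ 0 ≤ 0 + p - 1) by omega)]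
      simp only [add_zero]
      ring
    rw [if_pos (show 1 ≤ m ∧ m ≤ m + n - 1 by omega),
      if_pos (show 1 ≤ m ∧ m ≤ m + n + p - 1 by omega)]
    rcases Nat.eq_zero_or_pos p with rfl | hp
    · rw [if_neg (show ¬(1 ≤ m + n ∧ m + n ≤ m + n + 0 - 1) by omega),
        if_neg (show ¬(1 ≤ n ∧ n ≤ n + 0 - 1) by omega)]
      ring
    · rw [if_pos (show 1 ≤ m + n ∧ m + n ≤ m + n + p - 1 by omega),
        if_pos (show 1 ≤ n ∧ n ≤ n + p - 1 by omega), Nat.add_sub_assoc hn]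
      ring

/-- The graded algebra structure; the unit is the constant function `1` in degree `0`. -/
instance [One G] {c : Setoid G} (ι : scf c) : DirectSum.GSemiring (Piece ι) where
  mul_zero a := by
    apply Subtype.ext
    funext g
    exact mul_zero _
  zero_mul b := by
    apply Subtype.ext
    funext g
    change (0 : ℂ) * _ * _ = 0
    simp
  mul_add a b d := by
    apply Subtype.ext
    funext g
    exact mul_add _ _ _
  add_mul a b d := by
    apply Subtype.ext
    funext g
    change (_ + _) * _ * _ = (_ * _ * _ + _ * _ * _ : ℂ)
    rw [add_mul, add_mul]
  natCast k := scalarPiece ι k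
  natCast_zero := by
    apply Subtype.ext
    funext g
    change ((0 : ℕ) : ℂ) * 1 = 0
    simp
  natCast_succ k := by
    apply Subtype.ext
    funext g
    change ((k + 1 : ℕ) : ℂ) * 1 = (k : ℂ) * 1 + 1 * 1
    push_cast
    ring

instance [One G] {c : Setoid G} (ι : scf c) : DirectSum.GAlgebra ℂ (Piece ι) where
  toFun :=
    { toFun := scalarPiece ι
      map_zero' := zero_smul ℂ (scf.one (powSetoid c (0 - 1)))
      map_add' := fun x y => add_smul x y (scf.one (powSetoid c (0 - 1))) }
  map_one := rfl
  map_mul x y := by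
    refine .trans ?_ (scalar_mul ι x (scalarPiece ι y)).symm
    exact congrArg (GradedMonoid.mk 0) (mul_smul x y (scf.one (powSetoid c (0 - 1))))
  commutes x a := by
    obtain ⟨n, a⟩ := a
    exact (scalar_mul ι x a).trans (mul_scalar ι x a).symm
  smul_def x a := by
    obtain ⟨n, a⟩ := a
    exact (scalar_mul ι x a).symm

/-! The coproduct.  A subset `A` of `{1, …, n}` is regarded as the set composition `(A, Aᶜ)`; the
coordinate `j` of `G^{n-1}` sits between `j` and `j+1`. -/

/-- The element `j` of `{1, …, n}`, for a coordinate `j` of `G^{n-1}`. -/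
def lo {n : ℕ} (j : Fin (n - 1)) : Fin n := ⟨j, by omega⟩

/-- The element `j + 1` of `{1, …, n}`, for a coordinate `j` of `G^{n-1}`. -/
def hi {n : ℕ} (j : Fin (n - 1)) : Fin n := ⟨j + 1, by omega⟩

/-- `lc(A, Aᶜ)_j = 1`: `j` is not the maximum of its block. -/
def Lc {n : ℕ} (A : Finset (Fin n)) (j : Fin (n - 1)) : Prop :=
  ∃ i, lo j < i ∧ (i ∈ A ↔ lo j ∈ A)

/-- `llc(A, Aᶜ)_j = 1`: `j + 1` is in the block of `j` or in a later one. -/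
def Llc {n : ℕ} (A : Finset (Fin n)) (j : Fin (n - 1)) : Prop :=
  lo j ∈ A ∨ hi j ∉ A

/-- `bc(A, Aᶜ)_j = 1`: `j + 1` is in the block of `j`. -/
def Bc {n : ℕ} (A : Finset (Fin n)) (j : Fin (n - 1)) : Prop :=
  lo j ∈ A ↔ hi j ∈ A

/-- The function `h ↦ h_i` on `G^{k-1}`, extended by `h_k = 1`. -/
def coord [One G] {k : ℕ} (h : Fin (k - 1) → G) (i : Fin k) : G :=
  if hi : i.val < k - 1 then h ⟨i, hi⟩ else 1

/-- The isomorphism of `G^{|A|-1} × G^{|Aᶜ|-1}` with the subgroup of `G^{n-1}` of the elements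
supported on the coordinates `j` with `lc(A, Aᶜ)_j = 1`, which sends the entry of the `i`-th element
of a block to the coordinate that is this element. -/
def shuffle [One G] {n : ℕ} (A : Finset (Fin n))
    (p : (Fin (A.card - 1) → G) × (Fin (Aᶜ.card - 1) → G)) (j : Fin (n - 1)) : G :=
  Sum.elim (coord p.1) (coord p.2) ((finSumEquivOfFinset (s := A) rfl rfl).symm (lo j))

theorem shuffle_rel [One G] (c : Setoid G) {n : ℕ} (A : Finset (Fin n))
    {p p' : (Fin (A.card - 1) → G) × (Fin (Aᶜ.card - 1) → G)}
    (h : ((powSetoid c _).prod (powSetoid c _)) p p') (j : Fin (n - 1)) :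
    c (shuffle A p j) (shuffle A p' j) := by
  unfold shuffle
  rcases (finSumEquivOfFinset (s := A) rfl rfl).symm (lo j) with i | i
  · simp only [Sum.elim_inl, coord]
    split_ifs with hi
    · exact h.1 _
    · exact c.refl' _
  · simp only [Sum.elim_inr, coord]
    split_ifs with hi
    · exact h.2 _
    · exact c.refl' _

open Classical in
/-- Deflation from `G^k` to the factors in the coordinates `j` with `a j`: average over the
remaining coordinates. (The result is written as a function on `G^k` which depends only on the
coordinates `j` with `a j`, so that restricting it to a larger set of factors is the inflation.) -/
def defl [Fintype G] {k : ℕ} (a : Fin k → Prop) (φ : (Fin k → G) → ℂ) (h : Fin k → G) : ℂ :=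
  (Fintype.card (Fin k → G) : ℂ)⁻¹ * ∑ x : Fin k → G, φ (fun j => if a j then h j else x j)

open Classical in
/-- The factoring function with factor `τ` where `bc < lc`, and `1` elsewhere. -/
def tauFactor {c : Setoid G} (τ : scf c) {n : ℕ} (A : Finset (Fin n)) (h : Fin (n - 1) → G) : ℂ :=
  ∏ j, if ¬ Bc A j ∧ Lc A j then τ.1 (h j) else 1

open Classical in
/-- The factoring function with factor `1` where `bc = 1`, `α` where `bc < llc`, and `β` where
`llc = 0`. -/
def alphaBeta {c : Setoid G} (α β : scf c) {n : ℕ} (A : Finset (Fin n)) (h : Fin (n - 1) → G) : ℂ :=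
  ∏ j, if Bc A j then 1 else if Llc A j then α.1 (h j) else β.1 (h j)

/-- The map `scf(G^{n-1}) → scf(G^{|A|-1} × G^{|Aᶜ|-1})`,
`ψ ↦ τ_A ⊙ Inf (Def ((α × β)_A ⊙ ψ))`, read through the isomorphism `shuffle`. -/
def down [Group G] [Fintype G] {c : Setoid G} (τ α β : scf c) {n : ℕ} (A : Finset (Fin n)) :
    scf (powSetoid c (n - 1)) →ₗ[ℂ]
      scf ((powSetoid c (A.card - 1)).prod (powSetoid c (Aᶜ.card - 1))) where
  toFun ψ := ⟨fun p => tauFactor τ A (shuffle A p)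
      * defl (Bc A) (fun x => alphaBeta α β A x * ψ.1 x) (shuffle A p), by
    classical
    intro p p' h
    have hs := shuffle_rel c A h
    have h1 : tauFactor τ A (shuffle A p) = tauFactor τ A (shuffle A p') := by
      refine Finset.prod_congr rfl fun j _ => ?_
      rw [τ.2 _ _ (hs j)]
    dsimp only
    rw [h1]
    congr 1
    · unfold defl
      congr 1
      refine Finset.sum_congr rfl fun x _ => ?_
      have hx : ∀ j, c (if Bc A j then shuffle A p j else x j)
          (if Bc A j then shuffle A p' j else x j) := by
        intro j
        split_ifs
        · exact hs j
        · exact c.refl' _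
      have h2 : ∀ y y' : Fin (n - 1) → G, (∀ j, c (y j) (y' j)) →
          alphaBeta α β A y = alphaBeta α β A y' := by
        intro y y' hy
        refine Finset.prod_congr rfl fun j _ => ?_
        rw [α.2 _ _ (hy j), β.2 _ _ (hy j)]
      dsimp only
      rw [h2 _ _ hx]
      congr 1
      · exact ψ.2 _ _ hx⟩
  map_add' ψ γ := by
    apply Subtype.ext
    funext p
    simp [defl, mul_add, Finset.sum_add_distrib]
  map_smul' z ψ := by
    apply Subtype.ext
    funext p
    simp only [defl, Submodule.coe_smul, Pi.smul_apply, smul_eq_mul, RingHom.id_apply]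
    simp only [mul_left_comm _ z, ← Finset.mul_sum]

/-- `ℋ_(ι,α,β)`: the space `⨁_{n ≥ 0} scf(G^{n-1})`, with the product that uses `ι` and the
coproduct that uses `τ = ι`, `α` and `β`. -/
def TowerAlg {c : Setoid G} (ι _α _β : scf c) : Type _ := ⨁ n, Piece ι n

namespace TowerAlg

variable [Group G] {c : Setoid G} (ι α β : scf c)

instance : Semiring (TowerAlg ι α β) := inferInstanceAs (Semiring (⨁ n, Piece ι n))

instance : Algebra ℂ (TowerAlg ι α β) := inferInstanceAs (Algebra ℂ (⨁ n, Piece ι n))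

/-- The inclusion of the degree `n` component. -/
def incl (n : ℕ) : scf (powSetoid c (n - 1)) →ₗ[ℂ] TowerAlg ι α β :=
  (DirectSum.lof ℂ ℕ (Piece ι) n : Piece ι n →ₗ[ℂ] ⨁ n, Piece ι n)

/-- The linear map out of `ℋ_(ι,α,β)` with given restrictions to the components. -/
def lift {M : Type*} [AddCommMonoid M] [Module ℂ M]
    (f : ∀ n, scf (powSetoid c (n - 1)) →ₗ[ℂ] M) : TowerAlg ι α β →ₗ[ℂ] M :=
  (DirectSum.toModule ℂ ℕ M (fun n => (f n : Piece ι n →ₗ[ℂ] M)) : (⨁ n, Piece ι n) →ₗ[ℂ] M)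

theorem lift_incl {M : Type*} [AddCommMonoid M] [Module ℂ M]
    (f : ∀ n, scf (powSetoid c (n - 1)) →ₗ[ℂ] M) (n : ℕ) (ψ : scf (powSetoid c (n - 1))) :
    lift ι α β f (incl ι α β n ψ) = f n ψ :=
  DirectSum.toModule_lof ℂ (M := Piece ι) n ψ

/-- The coproduct is the sum over all `A ⊆ {1, …, n}` of the maps `down`; the counit is the
projection onto degree `0`. -/
instance [Fintype G] : CoalgebraStruct ℂ (TowerAlg ι α β) where
  comul := lift ι α β fun n => ∑ A : Finset (Fin n),
    TensorProduct.map (incl ι α β A.card) (incl ι α β Aᶜ.card)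
      ∘ₗ scf.toTensor _ _ ∘ₗ down ι α β A
  counit := lift ι α β fun n =>
    if n = 0 then LinearMap.proj (fun _ => 1) ∘ₗ (scf (powSetoid c (n - 1))).subtype else 0

end TowerAlg

end GroupTower
/-! ### Unipotent upper triangular matrices -/

section Unipotent

variable (F : Type*) [Field F]

/-- Square matrices of size `n`. -/
abbrev Mat (n : ℕ) : Type _ := Matrix (Fin n) (Fin n) F

/-- The unipotent upper triangular matrices of size `n`. -/
def unipotent (n : ℕ) : Submonoid (Mat F n) where
  carrier := {u | u.BlockTriangular id ∧ ∀ i, u i i = 1}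
  one_mem' := ⟨Matrix.blockTriangular_one, fun i => Matrix.one_apply_eq i⟩
  mul_mem' := by
    rintro u v ⟨hu, hu'⟩ ⟨hv, hv'⟩
    refine ⟨hu.mul hv, fun i => ?_⟩
    rw [Matrix.mul_apply, Finset.sum_eq_single i, hu', hv', mul_one]
    · intro k _ hk
      rcases lt_or_gt_of_ne hk with h | h
      · rw [hu h, zero_mul]
      · rw [hv h, mul_zero]
    · simp

/-- The group `UT_n(F)`. -/
abbrev UT (n : ℕ) : Type _ := ↥(unipotent F n)

variable {F}

theorem UT.det_eq_one {n : ℕ} (u : UT F n) : (u : Mat F n).det = 1 := by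
  rw [Matrix.det_of_isUpperTriangular u.2.1]
  exact Finset.prod_eq_one fun i _ => u.2.2 i

theorem UT.inv_mem {n : ℕ} (u : UT F n) : (u : Mat F n)⁻¹ ∈ unipotent F n := by
  have hdet : IsUnit (u : Mat F n).det := by rw [u.det_eq_one]; exact isUnit_one
  let := Matrix.invertibleOfIsUnitDet _ hdet
  have ht : ((u : Mat F n)⁻¹).BlockTriangular id :=
    Matrix.blockTriangular_inv_of_blockTriangular u.2.1
  refine ⟨ht, fun i => ?_⟩
  have h : ((u : Mat F n) * (u : Mat F n)⁻¹) i i = 1 := by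
    rw [Matrix.mul_nonsing_inv _ hdet, Matrix.one_apply_eq]
  rw [Matrix.mul_apply, Finset.sum_eq_single i, u.2.2, one_mul] at h
  · exact h
  · intro k _ hk
    rcases lt_or_gt_of_ne hk with h | h
    · rw [u.2.1 h, zero_mul]
    · rw [ht h, mul_zero]
  · simp

instance (n : ℕ) : Group (UT F n) where
  inv u := ⟨(u : Mat F n)⁻¹, u.inv_mem⟩
  inv_mul_cancel u := by
    apply Subtype.ext
    exact Matrix.nonsing_inv_mul _ (by rw [u.det_eq_one]; exact isUnit_one)

instance [Fintype F] (n : ℕ) : Fintype (UT F n) := Fintype.ofFinite _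

variable (F)

/-- The invertible upper triangular matrices. -/
def borel (n : ℕ) : Subgroup (GL (Fin n) F) where
  carrier := {x | (x : Mat F n).BlockTriangular id}
  one_mem' := Matrix.blockTriangular_one
  mul_mem' := fun hx hy => Matrix.BlockTriangular.mul hx hy
  inv_mem' := by
    intro x hx
    have hx' : (x : Mat F n).BlockTriangular id := hx
    let : Invertible (x : Mat F n) := x.invertible
    have h := Matrix.blockTriangular_inv_of_blockTriangular hx'
    rw [← Matrix.coe_units_inv] at h
    exact h

/-- The additive group of strictly upper triangular matrices. -/
def strictUpper (n : ℕ) : AddSubgroup (Mat F n) where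
  carrier := {a | ∀ i j, j ≤ i → a i j = 0}
  add_mem' := by
    intro a b ha hb i j h
    simp [ha i j h, hb i j h]
  zero_mem' := by
    intro i j _
    rfl
  neg_mem' := by
    intro a ha i j h
    simp [ha i j h]

variable {F}

theorem strictUpper_mul_mul {n : ℕ} {x y a : Mat F n} (hx : x.BlockTriangular id)
    (hy : y.BlockTriangular id) (ha : a ∈ strictUpper F n) : x * a * y ∈ strictUpper F n := by
  intro i j hij
  rw [Matrix.mul_apply]
  refine Finset.sum_eq_zero fun l _ => ?_
  rcases lt_or_ge j l with h | h
  · rw [hy h, mul_zero]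
  · rw [Matrix.mul_apply, Finset.sum_eq_zero, zero_mul]
    intro k _
    rcases lt_or_ge k i with h' | h'
    · rw [hx h', zero_mul]
    · rw [ha k l (h.trans (hij.trans h')), mul_zero]

/-- The two-sided action `a ↦ x a y` of `B_n` on the strictly upper triangular matrices. -/
def borelAct {n : ℕ} (x y : borel F n) (a : strictUpper F n) : strictUpper F n :=
  ⟨x.1.1 * a.1 * y.1.1, strictUpper_mul_mul x.2 y.2 a.2⟩

/-- The two-sided action `a ↦ x a y` of `UT_n` on the strictly upper triangular matrices. -/
def unipotentAct {n : ℕ} (x y : UT F n) (a : strictUpper F n) : strictUpper F n :=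
  ⟨x.1 * a.1 * y.1, strictUpper_mul_mul x.2.1 y.2.1 a.2⟩

/-- The strictly upper triangular matrix `u - 1`. -/
def UT.subOne {n : ℕ} (u : UT F n) : strictUpper F n :=
  ⟨u.1 - 1, by
    intro i j h
    rcases h.lt_or_eq with h | rfl
    · simp [u.2.1 h, Matrix.one_apply_ne h.ne']
    · simp [u.2.2 j]⟩

variable (F)

/-- The superclasses of `UT_n`: `u` and `v` are in the same superclass if
`u - 1 = x (v - 1) y` for invertible upper triangular matrices `x`, `y`. -/
def utCl (n : ℕ) : Setoid (UT F n) where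
  r u v := ∃ x y : borel F n, u.subOne = borelAct x y v.subOne
  iseqv := by
    refine ⟨fun u => ⟨1, 1, ?_⟩, ?_, ?_⟩
    · apply Subtype.ext
      simp [borelAct]
    · rintro u v ⟨x, y, h⟩
      refine ⟨x⁻¹, y⁻¹, ?_⟩
      rw [h]
      apply Subtype.ext
      simp [borelAct, mul_assoc]
    · rintro u v w ⟨x, y, h⟩ ⟨x', y', h'⟩
      refine ⟨x * x', y' * y, ?_⟩
      rw [h, h']
      apply Subtype.ext
      simp [borelAct, mul_assoc]

variable {F}

open Classical in
/-- For a character `θ` of the additive group of strictly upper triangular matrices, the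
supercharacter
`u ↦ |θ UT_n| / |UT_n θ UT_n| · ∑_{μ ∈ B_n θ B_n} μ(u - 1)` of `UT_n`. -/
def utSuperchar [Fintype F] {n : ℕ} (θ : AddChar (strictUpper F n) ℂ) (u : UT F n) : ℂ :=
  (Nat.card {μ : AddChar (strictUpper F n) ℂ // ∃ y : UT F n, ∀ a, μ a = θ (unipotentAct 1 y a)} : ℂ)
    / (Nat.card {μ : AddChar (strictUpper F n) ℂ //
        ∃ x y : UT F n, ∀ a, μ a = θ (unipotentAct x y a)} : ℂ)
    * ∑ μ : AddChar (strictUpper F n) ℂ,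
        if ∃ x y : borel F n, ∀ a, μ a = θ (borelAct x y a) then μ u.subOne else 0

variable (F)

/-- The set of supercharacters of `UT_n`. -/
def utCh [Fintype F] (n : ℕ) : Set (UT F n → ℂ) := Set.range utSuperchar

/-- The usual inner product of functions on a finite group. -/
def innerProd {H : Type*} [Fintype H] (ψ γ : H → ℂ) : ℂ :=
  (Fintype.card H : ℂ)⁻¹ * ∑ h, ψ h * starRingEnd ℂ (γ h)

/-- `χ` contains a linear character, i.e. some homomorphism `UT_n → ℂ^×` is a constituent. -/
def ContainsLinear [Fintype F] {n : ℕ} (χ : UT F n → ℂ) : Prop :=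
  ∃ ρ : UT F n →* ℂˣ, innerProd χ (fun u => (ρ u : ℂ)) ≠ 0

/-! The Hopf structure on `scf(UT_•)`. -/

/-- The degree `n` component `scf(UT_n)`. -/
def UPiece (n : ℕ) : Type _ := scf (utCl F n)

instance (n : ℕ) : AddCommGroup (UPiece F n) := inferInstanceAs (AddCommGroup (scf (utCl F n)))

instance (n : ℕ) : Module ℂ (UPiece F n) := inferInstanceAs (Module ℂ (scf (utCl F n)))

variable {F}

/-- The diagonal block of a unipotent upper triangular matrix in the rows and columns given by
`e`. -/
def UT.block {k n : ℕ} (e : Fin k ↪o Fin n) (u : UT F n) : UT F k :=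
  ⟨u.1.submatrix e e, fun _ _ h => u.2.1 (e.lt_iff_lt.mpr h), fun i => u.2.2 (e i)⟩

theorem submatrix_mul_of_interval {k n : ℕ} (e : Fin k ↪o Fin n)
    (he : (Set.range e).OrdConnected) {x y : Mat F n} (hx : x.BlockTriangular id)
    (hy : y.BlockTriangular id) :
    (x * y).submatrix e e = x.submatrix e e * y.submatrix e e := by
  ext i j
  simp only [Matrix.submatrix_apply, Matrix.mul_apply]
  symm
  refine Fintype.sum_of_injective e e.injective _ _ (fun l hl => ?_) (fun _ => rfl)
  rcases lt_or_ge l (e i) with h | h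
  · rw [hx h, zero_mul]
  rcases lt_or_ge (e j) l with h' | h'
  · rw [hy h', mul_zero]
  · exact absurd (he.out ⟨i, rfl⟩ ⟨j, rfl⟩ ⟨h, h'⟩) hl

/-- The diagonal block of an invertible upper triangular matrix along an interval. -/
def borelBlock {k n : ℕ} (e : Fin k ↪o Fin n) (he : (Set.range e).OrdConnected)
    (x : borel F n) : borel F k :=
  ⟨⟨x.1.1.submatrix e e, (x⁻¹).1.1.submatrix e e, by
      rw [← submatrix_mul_of_interval e he x.2 (x⁻¹).2, ← Units.val_mul, ← Subgroup.coe_mul,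
        mul_inv_cancel]
      exact Matrix.submatrix_one _ e.injective, by
      rw [← submatrix_mul_of_interval e he (x⁻¹).2 x.2, ← Units.val_mul, ← Subgroup.coe_mul,
        inv_mul_cancel]
      exact Matrix.submatrix_one _ e.injective⟩,
    fun _ _ h => x.2 (e.lt_iff_lt.mpr h)⟩

theorem strictUpper_blockTriangular {n : ℕ} (a : strictUpper F n) :
    a.1.BlockTriangular id := fun _ _ h => a.2 _ _ (le_of_lt h)

theorem block_rel {k n : ℕ} (e : Fin k ↪o Fin n) (he : (Set.range e).OrdConnected)
    {u v : UT F n} (h : utCl F n u v) : utCl F k (u.block e) (v.block e) := by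
  obtain ⟨x, y, h⟩ := h
  refine ⟨borelBlock e he x, borelBlock e he y, Subtype.ext ?_⟩
  have hsub : ∀ w : UT F n, (w.block e).subOne.1 = w.subOne.1.submatrix e e := by
    intro w
    simp only [UT.subOne, UT.block, Matrix.submatrix_sub, Pi.sub_apply]
    rw [Matrix.submatrix_one _ e.injective]
  rw [hsub, h]
  change (x.1.1 * v.subOne.1 * y.1.1).submatrix e e = _
  rw [submatrix_mul_of_interval e he (Matrix.BlockTriangular.mul x.2 (strictUpper_blockTriangular v.subOne)) y.2,
    submatrix_mul_of_interval e he x.2 (strictUpper_blockTriangular v.subOne), ← hsub]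
  rfl

theorem range_castAdd (m n : ℕ) : (Set.range (Fin.castAddOrderEmb (n := m) n)).OrdConnected := by
  refine ⟨?_⟩
  rintro _ ⟨a, rfl⟩ _ ⟨b, rfl⟩ c ⟨_, h⟩
  have h' : c.val ≤ b.val := h
  exact ⟨⟨c, by omega⟩, rfl⟩

theorem range_natAdd (m n : ℕ) : (Set.range (Fin.natAddOrderEmb (m := n) m)).OrdConnected := by
  refine ⟨?_⟩
  rintro _ ⟨a, rfl⟩ _ ⟨b, rfl⟩ c ⟨h, _⟩
  have h' : m + a.val ≤ c.val := h
  exact ⟨⟨c - m, by omega⟩, Fin.ext (show m + (c.val - m) = c.val by omega)⟩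

/-- The product in degrees `m`, `n`: inflation of `ψ ⊗ γ` from `UT_m × UT_n` to `UT_{m+n}` along the
surjection that takes a matrix to its two diagonal blocks of sizes `m` and `n`. -/
def mulUPiece {m n : ℕ} (ψ : UPiece F m) (γ : UPiece F n) : UPiece F (m + n) :=
  ⟨fun u => ψ.1 (u.block (Fin.castAddOrderEmb n)) * γ.1 (u.block (Fin.natAddOrderEmb m)), by
    intro u v h
    dsimp only
    rw [ψ.2 _ _ (block_rel _ (range_castAdd m n) h), γ.2 _ _ (block_rel _ (range_natAdd m n) h)]⟩

theorem upiece_ext {n n' : ℕ} (h : n = n') (f : UPiece F n) (f' : UPiece F n')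
    (H : ∀ u : UT F n', f.1 (u.block (Fin.castOrderIso h).toOrderEmbedding) = f'.1 u) :
    GradedMonoid.mk n f = GradedMonoid.mk n' f' := by
  subst h
  congr 1
  apply Subtype.ext
  funext u
  exact H u

/-- The scalar `z` times the unit of degree `0`. -/
def scalarUPiece (z : ℂ) : UPiece F 0 := (z • scf.one _ : scf (utCl F 0))

theorem scalar_mulU (z : ℂ) {n : ℕ} (a : UPiece F n) :
    GradedMonoid.mk (0 + n) (mulUPiece (scalarUPiece z) a) = GradedMonoid.mk n (z • a) := by
  refine upiece_ext (zero_add n) _ _ fun u => ?_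
  change (z * 1) * a.1 _ = z * a.1 u
  rw [mul_one]
  refine congrArg (fun w => z * a.1 w) (Subtype.ext ?_)
  ext i j
  exact congrArg₂ u.1 (Fin.ext (zero_add i.val)) (Fin.ext (zero_add j.val))

theorem mul_scalarU (z : ℂ) {n : ℕ} (a : UPiece F n) :
    GradedMonoid.mk (n + 0) (mulUPiece a (scalarUPiece z)) = GradedMonoid.mk n (z • a) := by
  refine upiece_ext (add_zero n) _ _ fun u => ?_
  change a.1 _ * (z * 1) = z * a.1 u
  rw [mul_one, mul_comm]
  rfl

instance : GradedMonoid.GMul (UPiece F) := ⟨mulUPiece⟩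

instance : GradedMonoid.GOne (UPiece F) := ⟨scalarUPiece 1⟩

instance : GradedMonoid.GMonoid (UPiece F) where
  one_mul a := by
    obtain ⟨n, a⟩ := a
    refine (scalar_mulU 1 a).trans ?_
    rw [one_smul]
    rfl
  mul_one a := by
    obtain ⟨n, a⟩ := a
    refine (mul_scalarU 1 a).trans ?_
    rw [one_smul]
    rfl
  mul_assoc a b d := by
    obtain ⟨m, a⟩ := a
    obtain ⟨n, b⟩ := b
    obtain ⟨p, d⟩ := d
    refine upiece_ext (add_assoc m n p) (mulUPiece (mulUPiece a b) d)
      (mulUPiece a (mulUPiece b d)) fun u => ?_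
    change (a.1 _ * b.1 _) * d.1 _ = a.1 _ * (b.1 _ * d.1 _)
    rw [mul_assoc]
    refine congrArg (fun w => _ * (_ * d.1 w)) (Subtype.ext ?_)
    ext i j
    exact congrArg₂ u.1 (Fin.ext (add_assoc m n i.val)) (Fin.ext (add_assoc m n j.val))

/-- The graded algebra structure; the unit is the constant function `1` in degree `0`. -/
instance : DirectSum.GSemiring (UPiece F) where
  mul_zero a := by
    apply Subtype.ext
    funext g
    exact mul_zero _
  zero_mul b := by
    apply Subtype.ext
    funext g
    exact zero_mul _
  mul_add a b d := by
    apply Subtype.ext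
    funext g
    exact mul_add _ _ _
  add_mul a b d := by
    apply Subtype.ext
    funext g
    exact add_mul _ _ _
  natCast k := scalarUPiece k
  natCast_zero := by
    apply Subtype.ext
    funext g
    change ((0 : ℕ) : ℂ) * 1 = 0
    simp
  natCast_succ k := by
    apply Subtype.ext
    funext g
    change ((k + 1 : ℕ) : ℂ) * 1 = (k : ℂ) * 1 + 1 * 1
    push_cast
    ring

instance : DirectSum.GAlgebra ℂ (UPiece F) where
  toFun :=
    { toFun := scalarUPiece
      map_zero' := zero_smul ℂ (scf.one (utCl F 0))
      map_add' := fun x y => add_smul x y (scf.one (utCl F 0)) }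
  map_one := rfl
  map_mul x y := by
    refine .trans ?_ (scalar_mulU x (scalarUPiece y)).symm
    exact congrArg (GradedMonoid.mk 0) (mul_smul x y (scf.one (utCl F 0)))
  commutes x a := by
    obtain ⟨n, a⟩ := a
    exact (scalar_mulU x a).trans (mul_scalarU x a).symm
  smul_def x a := by
    obtain ⟨n, a⟩ := a
    exact (scalar_mulU x a).symm

/-- For `A ⊆ {1, …, n}`, the matrix with the entries of `a` in the rows and columns of `A`, the
entries of `b` in the rows and columns of `Aᶜ` (in order), and `0` elsewhere. -/
def shuffleMat {n : ℕ} (A : Finset (Fin n)) (a : Mat F A.card) (b : Mat F Aᶜ.card) : Mat F n :=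
  Matrix.reindex (finSumEquivOfFinset (s := A) rfl rfl) (finSumEquivOfFinset (s := A) rfl rfl)
    (Matrix.fromBlocks a 0 0 b)

theorem shuffleMat_mul {n : ℕ} (A : Finset (Fin n)) (a a' : Mat F A.card) (b b' : Mat F Aᶜ.card) :
    shuffleMat A (a * a') (b * b') = shuffleMat A a b * shuffleMat A a' b' := by
  simp [shuffleMat, Matrix.submatrix_mul_equiv, Matrix.fromBlocks_multiply]

theorem shuffleMat_one {n : ℕ} (A : Finset (Fin n)) :
    shuffleMat A (1 : Mat F A.card) (1 : Mat F Aᶜ.card) = 1 := by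
  simp [shuffleMat]

theorem shuffleMat_sub {n : ℕ} (A : Finset (Fin n)) (a a' : Mat F A.card) (b b' : Mat F Aᶜ.card) :
    shuffleMat A (a - a') (b - b') = shuffleMat A a b - shuffleMat A a' b' := by
  ext i j
  simp only [shuffleMat, Matrix.reindex_apply, Matrix.submatrix_apply, Matrix.sub_apply]
  rcases (finSumEquivOfFinset (s := A) rfl rfl).symm i with i | i <;>
  rcases (finSumEquivOfFinset (s := A) rfl rfl).symm j with j | j <;> simp

theorem shuffleMat_blockTriangular {n : ℕ} (A : Finset (Fin n)) {a : Mat F A.card}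
    {b : Mat F Aᶜ.card} (ha : a.BlockTriangular id) (hb : b.BlockTriangular id) :
    (shuffleMat A a b).BlockTriangular id := by
  intro i j hij
  obtain ⟨i, rfl⟩ := (finSumEquivOfFinset (s := A) rfl rfl).surjective i
  obtain ⟨j, rfl⟩ := (finSumEquivOfFinset (s := A) rfl rfl).surjective j
  simp only [shuffleMat, Matrix.reindex_apply, Matrix.submatrix_apply, Equiv.symm_apply_apply]
  rcases i with i | i <;> rcases j with j | j
  · refine ha ?_
    simpa using hij
  · rfl
  · rfl
  · refine hb ?_
    simpa using hij

/-- The isomorphism of `UT_{|A|} × UT_{|Aᶜ|}` with the subgroup of `UT_n` of the matrices whose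
nonzero entries above the diagonal are in positions `(i, j)` with `i`, `j` in the same block of
`(A, Aᶜ)`. -/
def shuffleUT {n : ℕ} (A : Finset (Fin n)) (p : UT F A.card × UT F Aᶜ.card) : UT F n :=
  ⟨shuffleMat A p.1.1 p.2.1, shuffleMat_blockTriangular A p.1.2.1 p.2.2.1, by
    intro i
    obtain ⟨i, rfl⟩ := (finSumEquivOfFinset (s := A) rfl rfl).surjective i
    simp only [shuffleMat, Matrix.reindex_apply, Matrix.submatrix_apply, Equiv.symm_apply_apply]
    rcases i with i | i
    · exact p.1.2.2 i
    · exact p.2.2.2 i⟩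

/-- The same embedding for the groups of invertible upper triangular matrices. -/
def shuffleBorel {n : ℕ} (A : Finset (Fin n)) (x : borel F A.card) (y : borel F Aᶜ.card) :
    borel F n :=
  ⟨⟨shuffleMat A x.1.1 y.1.1, shuffleMat A x.1⁻¹.1 y.1⁻¹.1, by
      rw [← shuffleMat_mul, Units.mul_inv, Units.mul_inv, shuffleMat_one], by
      rw [← shuffleMat_mul, Units.inv_mul, Units.inv_mul, shuffleMat_one]⟩,
    shuffleMat_blockTriangular A x.2 y.2⟩

theorem shuffleUT_rel {n : ℕ} (A : Finset (Fin n)) {p p' : UT F A.card × UT F Aᶜ.card}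
    (h : ((utCl F _).prod (utCl F _)) p p') : utCl F n (shuffleUT A p) (shuffleUT A p') := by
  obtain ⟨⟨x, y, h⟩, ⟨x', y', h'⟩⟩ := h
  have hsub : ∀ q : UT F A.card × UT F Aᶜ.card,
      (shuffleUT A q).subOne.1 = shuffleMat A q.1.subOne.1 q.2.subOne.1 := by
    intro q
    change shuffleMat A q.1.1 q.2.1 - 1 = shuffleMat A (q.1.1 - 1) (q.2.1 - 1)
    rw [shuffleMat_sub, shuffleMat_one]
  refine ⟨shuffleBorel A x x', shuffleBorel A y y', Subtype.ext ?_⟩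
  rw [hsub, h, h']
  change shuffleMat A (x.1.1 * p'.1.subOne.1 * y.1.1) (x'.1.1 * p'.2.subOne.1 * y'.1.1)
    = shuffleMat A x.1.1 x'.1.1 * (shuffleUT A p').subOne.1 * shuffleMat A y.1.1 y'.1.1
  rw [hsub, shuffleMat_mul, shuffleMat_mul]

/-- Restriction of superclass functions from `UT_n` to `UT_{|A|} × UT_{|Aᶜ|}`. -/
def resUT {n : ℕ} (A : Finset (Fin n)) :
    scf (utCl F n) →ₗ[ℂ] scf ((utCl F A.card).prod (utCl F Aᶜ.card)) where
  toFun ψ := ⟨fun p => ψ.1 (shuffleUT A p), fun _ _ h => ψ.2 _ _ (shuffleUT_rel A h)⟩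
  map_add' _ _ := rfl
  map_smul' _ _ := rfl

variable (F)

/-- `scf(UT_•) = ⨁_{n ≥ 0} scf(UT_n)`. -/
def ScfUT : Type _ := ⨁ n, UPiece F n

namespace ScfUT

instance : Semiring (ScfUT F) := inferInstanceAs (Semiring (⨁ n, UPiece F n))

instance : Algebra ℂ (ScfUT F) := inferInstanceAs (Algebra ℂ (⨁ n, UPiece F n))

/-- The inclusion of the degree `n` component. -/
def incl (n : ℕ) : scf (utCl F n) →ₗ[ℂ] ScfUT F :=
  (DirectSum.lof ℂ ℕ (UPiece F) n : UPiece F n →ₗ[ℂ] ⨁ n, UPiece F n)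

/-- The linear map out of `scf(UT_•)` with given restrictions to the components. -/
def lift {M : Type*} [AddCommMonoid M] [Module ℂ M]
    (f : ∀ n, scf (utCl F n) →ₗ[ℂ] M) : ScfUT F →ₗ[ℂ] M :=
  (DirectSum.toModule ℂ ℕ M (fun n => (f n : UPiece F n →ₗ[ℂ] M)) : (⨁ n, UPiece F n) →ₗ[ℂ] M)

theorem lift_incl {M : Type*} [AddCommMonoid M] [Module ℂ M]
    (f : ∀ n, scf (utCl F n) →ₗ[ℂ] M) (n : ℕ) (ψ : scf (utCl F n)) :
    lift F f (incl F n ψ) = f n ψ :=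
  DirectSum.toModule_lof ℂ (M := UPiece F) n ψ

/-- The coproduct is the sum over all `A ⊆ {1, …, n}` of the restrictions to
`UT_{|A|} × UT_{|Aᶜ|}`; the counit is the projection onto degree `0`. -/
instance [Fintype F] : CoalgebraStruct ℂ (ScfUT F) where
  comul := lift F fun n => ∑ A : Finset (Fin n),
    TensorProduct.map (incl F A.card) (incl F Aᶜ.card) ∘ₗ scf.toTensor _ _ ∘ₗ resUT A
  counit := lift F fun n =>
    if n = 0 then LinearMap.proj (1 : UT F n) ∘ₗ (scf (utCl F n)).subtype else 0

end ScfUT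

/-! ### Inflation from the abelianization -/

theorem superdiag_mul {n : ℕ} {x y : Mat F n} (hx : x.BlockTriangular id)
    (hy : y.BlockTriangular id) (i : Fin (n - 1)) :
    (x * y) (lo i) (hi i) = x (lo i) (lo i) * y (lo i) (hi i) + x (lo i) (hi i) * y (hi i) (hi i)
    := by
  have hne : (lo i : Fin n) ≠ hi i := by
    intro h
    have := congrArg Fin.val h
    simp [lo, hi] at this
  rw [Matrix.mul_apply, Finset.sum_eq_add (lo i) (hi i) hne]
  · rintro k - ⟨h1, h2⟩
    rcases lt_or_gt_of_ne h1 with h | h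
    · rw [show x (lo i) k = 0 from hx h, zero_mul]
    rcases lt_or_gt_of_ne h2 with h' | h'
    · have a1 : i.val < k.val := h
      have a2 : k.val < i.val + 1 := h'
      omega
    · rw [show y k (hi i) = 0 from hy h', mul_zero]
  · simp
  · simp

/-- The homomorphism `UT_n → G^{n-1}`, `G = F^+`, that takes a matrix to its first superdiagonal. -/
def superdiag (n : ℕ) : UT F n →* (Fin (n - 1) → Multiplicative F) where
  toFun u i := Multiplicative.ofAdd (u.1 (lo i) (hi i))
  map_one' := by
    funext i
    have hne : (lo i : Fin n) ≠ hi i := by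
      intro h
      have := congrArg Fin.val h
      simp [lo, hi] at this
    exact congrArg Multiplicative.ofAdd (Matrix.one_apply_ne hne)
  map_mul' u v := by
    funext i
    change Multiplicative.ofAdd ((u.1 * v.1) (lo i) (hi i)) = Multiplicative.ofAdd (_ + _)
    rw [superdiag_mul F u.2.1 v.2.1, u.2.2, v.2.2, one_mul, mul_one, add_comm]
    rfl

theorem superdiag_rel {n : ℕ} {u v : UT F n} (h : utCl F n u v) :
    powSetoid (trivialCl (Multiplicative F)) (n - 1) (superdiag F n u) (superdiag F n v) := by
  obtain ⟨x, y, h⟩ := h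
  intro i
  have hne : (lo i : Fin n) ≠ hi i := by
    intro h
    have := congrArg Fin.val h
    simp [lo, hi] at this
  have hs : ∀ w : UT F n, w.subOne.1 (lo i) (hi i) = w.1 (lo i) (hi i) := by
    intro w
    change w.1 _ _ - (1 : Mat F n) _ _ = _
    rw [Matrix.one_apply_ne hne, sub_zero]
  have hd : ∀ (z : borel F n) (k : Fin n), z.1.1 k k ≠ 0 := by
    intro z k hk
    have hdet : z.1.1.det ≠ 0 := ((Matrix.isUnit_iff_isUnit_det _).mp z.1.isUnit).ne_zero
    rw [Matrix.det_of_isUpperTriangular z.2] at hdet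
    exact hdet (Finset.prod_eq_zero (Finset.mem_univ k) hk)
  have hz : ∀ (a : strictUpper F n) (k : Fin n), a.1 k k = 0 := fun a k => a.2 k k le_rfl
  have key : u.1 (lo i) (hi i) = x.1.1 (lo i) (lo i) * v.1 (lo i) (hi i) * y.1.1 (hi i) (hi i) := by
    rw [← hs u, ← hs v, h]
    change (x.1.1 * v.subOne.1 * y.1.1) (lo i) (hi i) = _
    rw [superdiag_mul F (Matrix.BlockTriangular.mul x.2 (strictUpper_blockTriangular v.subOne)) y.2,
      superdiag_mul F x.2 (strictUpper_blockTriangular v.subOne), hz, mul_zero, add_zero]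
    have : (x.1.1 * v.subOne.1) (lo i) (lo i) = 0 :=
      by simpa using strictUpper_mul_mul x.2 Matrix.blockTriangular_one v.subOne.2 (lo i) (lo i) le_rfl
    rw [this, zero_mul, zero_add]
  change u.1 (lo i) (hi i) = 0 ↔ v.1 (lo i) (hi i) = 0
  rw [key]
  simp [hd]

/-- Inflation `scf(G^{n-1}) → scf(UT_n)`, `G = F^+`, along `UT_n → UT_n/[UT_n, UT_n] ≅ G^{n-1}`. -/
def infl (n : ℕ) :
    scf (powSetoid (trivialCl (Multiplicative F)) (n - 1)) →ₗ[ℂ] scf (utCl F n) where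
  toFun ψ := ⟨fun u => ψ.1 (superdiag F n u), fun _ _ h => ψ.2 _ _ (superdiag_rel F h)⟩
  map_add' _ _ := rfl
  map_smul' _ _ := rfl

/-- `ℋ_(1,reg,reg)` for `G = F^+` with superclasses `{0}` and `F - {0}`. -/
abbrev HOne [Fintype F] : Type _ :=
  TowerAlg (scf.one (trivialCl (Multiplicative F))) (reg (Multiplicative F))
    (reg (Multiplicative F))

end Unipotent

end TowerHopf

end

/-!
All Hopf algebra axioms are checked on evaluation functionals. The functional `ScfUT.ev p x`
evaluates the component of degree `p` of an element of `scf(UT_•)` at the matrix `x`; these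
functionals separate points, and so do their tensor products (`Separating.tmul`). Matrices are
encoded as functions on `ℕ × ℕ`, so that their sizes can vary without casts. In these terms the
product splits a matrix into diagonal blocks (`ScfUT.ev_mul`), and the coproduct is dual to the sum
over all shuffles of two matrices (`ScfUT.tmulFunctional_comul`). Coassociativity then says that both
iterated shuffles run over all divisions of `{0, …, N-1}` into three parts
(`ScfUT.sum_ev_shuffleFun`), and multiplicativity of the coproduct says that a subset of
`{0, …, m+n-1}` is a subset of the first `m` and one of the last `n` indices (`ScfUT.comul_mul`).
The antipode exists because the bialgebra is graded and connected (`exists_antipode`).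

For `ℋ`, multiplication by `reg` followed by deflation is evaluation at the identity
(`down_one_reg_reg`), which is what restriction to a block subgroup does to the superdiagonal
(`superdiag_shuffleUT`). Hence inflation respects all operations. It is injective, because the
superdiagonal is surjective, and so the bialgebra axioms descend from `scf(UT_•)` to `ℋ`.

A unipotent matrix with zero superdiagonal is a product of elementary matrices off the superdiagonal,
which are commutators (`mem_commutator_of_superdiag_eq_one`); this gives the abelianization. It
follows that the linear characters of `UT_n` are the functions `u ↦ θ(u - 1)` for the characters
`θ` of `ut_n` that factor through the superdiagonal. The orbits of such `θ` are computed explicitly: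
their supercharacters are the inflations of the supercharacters of `G^{n-1}`
(`utSuperchar_linChar`). Conversely, by orthogonality of the characters of `ut_n`, a linear character
occurs in `χ^θ` only if it comes from the orbit of `θ` (`innerProd_utSuperchar`).
-/

noncomputable section

open scoped commutatorElement

namespace TowerHopf

/-! ### Functionals on tensor products -/

section Functionals

variable {M N I J : Type*} [AddCommMonoid M] [AddCommMonoid N] [Module ℂ M] [Module ℂ N]

/-- The functional `f ⊗ g` on a tensor product. -/
def tmulFunctional (f : M →ₗ[ℂ] ℂ) (g : N →ₗ[ℂ] ℂ) : M ⊗[ℂ] N →ₗ[ℂ] ℂ :=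
  LinearMap.mul' ℂ ℂ ∘ₗ TensorProduct.map f g

@[simp]
theorem tmulFunctional_tmul (f : M →ₗ[ℂ] ℂ) (g : N →ₗ[ℂ] ℂ) (m : M) (n : N) :
    tmulFunctional f g (m ⊗ₜ n) = f m * g n := rfl

/-- A family of functionals is separating if its joint kernel is trivial. As the modules carry no
subtraction, this is expressed by injectivity. -/
def Separating (f : I → M →ₗ[ℂ] ℂ) : Prop :=
  ∀ m m', (∀ i, f i m = f i m') → m = m'

/-- Over a field, the products of the functionals of two separating families separate the points of the
tensor product: apply the first family to the first factor, then compare coordinates in a basis of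
the second factor. -/
theorem Separating.tmul {f : I → M →ₗ[ℂ] ℂ} (hf : Separating f) {g : J → N →ₗ[ℂ] ℂ}
    (hg : Separating g) :
    Separating (fun p : I × J => tmulFunctional (f p.1) (g p.2)) := by
  intro z z' hz
  let : AddCommGroup N := Module.addCommMonoidToAddCommGroup ℂ
  let b := Module.Free.chooseBasis ℂ N
  have h1 : ∀ i, TensorProduct.lid ℂ N ((f i).rTensor N z)
      = TensorProduct.lid ℂ N ((f i).rTensor N z') := by
    intro i
    refine hg _ _ fun j => ?_
    have hc : g j ∘ₗ (TensorProduct.lid ℂ N).toLinearMap ∘ₗ (f i).rTensor N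
        = tmulFunctional (f i) (g j) := by
      ext m n
      simp
    have : tmulFunctional (f i) (g j) z = tmulFunctional (f i) (g j) z' := hz (i, j)
    rw [← hc] at this
    exact this
  apply (TensorProduct.equivFinsuppOfBasisRight (M := M) b).injective
  ext k
  refine hf _ _ fun i => ?_
  have hc : f i ∘ₗ Finsupp.lapply k ∘ₗ (TensorProduct.equivFinsuppOfBasisRight (M := M) b).toLinearMap
      = b.coord k ∘ₗ (TensorProduct.lid ℂ N).toLinearMap ∘ₗ (f i).rTensor N := by
    ext m n
    simp [mul_comm]
  have e1 := LinearMap.congr_fun hc z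
  have e2 := LinearMap.congr_fun hc z'
  simp only [LinearMap.comp_apply, LinearEquiv.coe_coe, Finsupp.lapply_apply] at e1 e2
  rw [e1, e2, h1]

end Functionals

/-! ### Antipodes of connected graded bialgebras -/

section Antipode

variable {M : ℕ → Type*} [∀ n, AddCommMonoid (M n)] [∀ n, Module ℂ (M n)]
  {A : Type*} [Ring A] [Algebra ℂ A]

open WithConv in
/-- The case of a ring, in which the geometric series can be computed in the convolution algebra. -/
theorem exists_antipode_ring [Coalgebra ℂ A] (e : (⨁ n, M n) ≃ₗ[ℂ] A)
    (hε : CoalgebraStruct.counit (R := ℂ) (1 : A) = 1)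
    (h0 : ∀ m : M 0, ∃ z : ℂ, e (DirectSum.lof ℂ ℕ M 0 m) = z • 1)
    (hΔ : ∀ n (m : M n), CoalgebraStruct.comul (R := ℂ) (e (DirectSum.lof ℂ ℕ M n m)) ∈
      Submodule.span ℂ {t : A ⊗[ℂ] A | ∃ (i j : ℕ) (x : M i) (y : M j), i + j = n ∧
        t = e (DirectSum.lof ℂ ℕ M i x) ⊗ₜ e (DirectSum.lof ℂ ℕ M j y)}) :
    ∃ S : A →ₗ[ℂ] A,
      LinearMap.mul' ℂ A ∘ₗ S.rTensor A ∘ₗ CoalgebraStruct.comul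
        = Algebra.linearMap ℂ A ∘ₗ CoalgebraStruct.counit ∧
      LinearMap.mul' ℂ A ∘ₗ S.lTensor A ∘ₗ CoalgebraStruct.comul
        = Algebra.linearMap ℂ A ∘ₗ CoalgebraStruct.counit := by
  -- `P N g`: the map `g` vanishes in all degrees below `N`
  let P : ℕ → WithConv (A →ₗ[ℂ] A) → Prop :=
    fun N g => ∀ k < N, ∀ m : M k, g.ofConv (e (DirectSum.lof ℂ ℕ M k m)) = 0
  have hmul : ∀ a b g h, P a g → P b h → P (a + b) (g * h) := by
    intro a b g h hg hh k hk m
    change LinearMap.mul' ℂ A (TensorProduct.map g.ofConv h.ofConv (CoalgebraStruct.comul _)) = 0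
    refine Submodule.span_induction ?_ ?_ ?_ ?_ (hΔ k m)
    · rintro _ ⟨i, j, x, y, hij, rfl⟩
      rcases lt_or_ge i a with hi | hi
      · simp [hg i hi x]
      · simp [hh j (by omega) y]
    · simp
    · intro x y _ _ hx hy
      simp only [map_add, hx, hy, add_zero]
    · intro c x _ hx
      simp only [map_smul, hx, smul_zero]
  have hzero : ∀ g, P 0 g := fun g k hk => absurd hk (Nat.not_lt_zero k)
  have hsub : ∀ N g h, P N g → P N h → P N (g - h) := by
    intro N g h hg hh k hk m
    have := congrArg₂ (· - ·) (hg k hk m) (hh k hk m)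
    simpa using this
  have hext : ∀ g h : WithConv (A →ₗ[ℂ] A), (∀ N, P N (g - h)) → g = h := by
    intro g h H
    have : g.ofConv ∘ₗ e.toLinearMap = h.ofConv ∘ₗ e.toLinearMap := by
      refine DirectSum.linearMap_ext ℂ fun n => LinearMap.ext fun m => ?_
      exact sub_eq_zero.mp (H (n + 1) n (Nat.lt_succ_self n) m)
    have h2 : g.ofConv = h.ofConv := by
      refine LinearMap.ext fun a => ?_
      simpa using LinearMap.congr_fun this (e.symm a)
    exact WithConv.ofConv_injective h2
  let J : WithConv (A →ₗ[ℂ] A) := toConv LinearMap.id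
  let f : WithConv (A →ₗ[ℂ] A) := 1 - J
  have hf : P 1 f := by
    intro k hk m
    obtain rfl : k = 0 := by omega
    obtain ⟨z, hz⟩ := h0 m
    rw [hz]
    change Algebra.linearMap ℂ A (CoalgebraStruct.counit (z • (1 : A))) - z • 1 = 0
    rw [map_smul, hε, map_smul, Algebra.linearMap_apply, map_one, sub_self]
  have hpow : ∀ N, P N (f ^ N) := by
    intro N
    induction N with
    | zero => exact hzero _
    | succ N ih => rw [pow_succ]; exact hmul _ _ _ _ ih hf
  -- the geometric series `∑ fᵏ`, which is a finite sum in each degree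
  let T : ℕ → WithConv (A →ₗ[ℂ] A) := fun N => ∑ k ∈ Finset.range N, f ^ k
  let S : WithConv (A →ₗ[ℂ] A) := toConv
    (DirectSum.toModule ℂ ℕ A
      (fun n => (T (n + 1)).ofConv ∘ₗ e.toLinearMap ∘ₗ DirectSum.lof ℂ ℕ M n) ∘ₗ e.symm.toLinearMap)
  have hS : ∀ n (m : M n), S.ofConv (e (DirectSum.lof ℂ ℕ M n m))
      = (T (n + 1)).ofConv (e (DirectSum.lof ℂ ℕ M n m)) := by
    intro n m
    simp [S]
  have hT : ∀ N k, k ≤ N → P k (T N - T k) := by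
    intro N k hk
    induction N, hk using Nat.le_induction with
    | base => intro i hi m; simp
    | succ N hN ih =>
      intro i hi m
      have e1 := ih i hi m
      have e2 := hpow N i (by omega) m
      have : T (N + 1) - T k = (T N - T k) + f ^ N := by
        simp only [T, Finset.sum_range_succ]; abel
      rw [this]
      change (T N - T k).ofConv _ + (f ^ N).ofConv _ = 0
      rw [e1, e2, add_zero]
  have hST : ∀ N, P N (S - T N) := by
    intro N k hk m
    have h1 := hT N (k + 1) hk k (Nat.lt_succ_self k) m
    change (T N).ofConv _ - (T (k + 1)).ofConv _ = 0 at h1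
    change S.ofConv _ - (T N).ofConv _ = 0
    rw [hS, ← neg_sub, h1, neg_zero]
  have hJ : J = 1 - f := by simp [f]
  have hl : S * J = 1 := by
    refine hext _ _ fun N => ?_
    have e1 : S * J - 1 = (S - T N) * J - f ^ N := by
      have : T N * J = 1 - f ^ N := by rw [hJ]; exact geom_sum_mul_neg f N
      rw [sub_mul, this]; abel
    rw [e1]
    exact hsub _ _ _ (hmul N 0 _ _ (hST N) (hzero _)) (hpow N)
  have hr : J * S = 1 := by
    refine hext _ _ fun N => ?_
    have e1 : J * S - 1 = J * (S - T N) - f ^ N := by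
      have : J * T N = 1 - f ^ N := by rw [hJ]; exact mul_neg_geom_sum f N
      rw [mul_sub, this]; abel
    rw [e1]
    have := hmul 0 N J _ (hzero _) (hST N)
    rw [zero_add] at this
    exact hsub _ _ _ this (hpow N)
  exact ⟨S.ofConv, congrArg WithConv.ofConv hl, congrArg WithConv.ofConv hr⟩

end Antipode

/-- A connected graded bialgebra has an antipode: the convolution inverse of the identity is the
geometric series in `ηε - id`, which has finitely many nonzero terms in each degree because
`ηε - id` vanishes in degree `0`. -/
theorem exists_antipode {M : ℕ → Type*} [∀ n, AddCommMonoid (M n)] [∀ n, Module ℂ (M n)]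
    {A : Type*} [Semiring A] [Algebra ℂ A] [co : CoalgebraStruct ℂ A]
    (hco : ∃ c : Coalgebra ℂ A, c.toCoalgebraStruct = co) (incl : ∀ n, M n →ₗ[ℂ] A)
    (e : (⨁ n, M n) ≃ₗ[ℂ] A) (he : ∀ n m, e (DirectSum.lof ℂ ℕ M n m) = incl n m)
    (hε : CoalgebraStruct.counit (R := ℂ) (1 : A) = 1)
    (h0 : ∀ m : M 0, ∃ z : ℂ, incl 0 m = z • 1)
    (hΔ : ∀ n (m : M n), CoalgebraStruct.comul (R := ℂ) (incl n m) ∈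
      Submodule.span ℂ {t : A ⊗[ℂ] A | ∃ (i j : ℕ) (x : M i) (y : M j), i + j = n ∧
        t = incl i x ⊗ₜ incl j y}) :
    ∃ S : A →ₗ[ℂ] A,
      LinearMap.mul' ℂ A ∘ₗ S.rTensor A ∘ₗ CoalgebraStruct.comul
        = Algebra.linearMap ℂ A ∘ₗ CoalgebraStruct.counit ∧
      LinearMap.mul' ℂ A ∘ₗ S.lTensor A ∘ₗ CoalgebraStruct.comul
        = Algebra.linearMap ℂ A ∘ₗ CoalgebraStruct.counit := by
  obtain ⟨c, rfl⟩ := hco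
  let : Ring A := Algebra.semiringToRing ℂ
  simp only [← he] at h0 hΔ
  exact exists_antipode_ring e hε h0 hΔ

/-! ### Evaluation functionals on superclass functions of unipotent groups -/

section Evaluation

variable {F : Type*} [Field F]

/-- The unipotent matrix of size `n` whose entries above the diagonal are given by `x`. Allowing
`x` to be any function on `ℕ × ℕ` makes it possible to change `n` without casts. -/
def UT.ofFun (n : ℕ) (x : ℕ → ℕ → F) : UT F n :=
  ⟨fun i j => if i < j then x i j else if i = j then 1 else 0, by
    refine ⟨fun i j h => ?_, fun i => ?_⟩
    · have h' : j < i := h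
      simp [not_lt_of_gt h', h'.ne']
    · simp⟩

theorem UT.ofFun_apply (n : ℕ) (x : ℕ → ℕ → F) (i j : Fin n) :
    (UT.ofFun n x).1 i j = if i < j then x i j else if i = j then 1 else 0 := rfl

theorem UT.ext_of_lt {n : ℕ} {u v : UT F n} (h : ∀ i j, i < j → u.1 i j = v.1 i j) : u = v := by
  apply Subtype.ext
  ext i j
  rcases lt_trichotomy i j with hij | rfl | hij
  · exact h i j hij
  · rw [u.2.2, v.2.2]
  · rw [u.2.1 hij, v.2.1 hij]

theorem UT.ofFun_congr {n : ℕ} {x y : ℕ → ℕ → F} (h : ∀ i j, i < j → j < n → x i j = y i j) :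
    UT.ofFun n x = UT.ofFun n y := by
  refine UT.ext_of_lt fun i j hij => ?_
  simp only [UT.ofFun_apply, if_pos hij]
  exact h i j hij j.2

theorem UT.exists_ofFun {n : ℕ} (u : UT F n) : ∃ x, UT.ofFun n x = u := by
  refine ⟨fun i j => if h : i < n ∧ j < n then u.1 ⟨i, h.1⟩ ⟨j, h.2⟩ else 0, ?_⟩
  refine UT.ext_of_lt fun i j hij => ?_
  simp [UT.ofFun_apply, hij]

namespace ScfUT

/-- The functional on `scf(UT_•)` that evaluates the component of degree `p` at the matrix given
by `x`. -/
def ev (p : ℕ) (x : ℕ → ℕ → F) : ScfUT F →ₗ[ℂ] ℂ :=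
  lift F fun n => if n = p then LinearMap.proj (UT.ofFun n x) ∘ₗ (scf (utCl F n)).subtype else 0

theorem ev_incl (p : ℕ) (x : ℕ → ℕ → F) (n : ℕ) (ψ : scf (utCl F n)) :
    ev p x (incl F n ψ) = if n = p then ψ.1 (UT.ofFun n x) else 0 := by
  rw [ev, lift_incl]
  split_ifs <;> rfl

theorem linearMap_ext {M : Type*} [AddCommMonoid M] [Module ℂ M] {f g : ScfUT F →ₗ[ℂ] M}
    (h : ∀ n ψ, f (incl F n ψ) = g (incl F n ψ)) : f = g :=
  DirectSum.linearMap_ext (M := UPiece F) ℂ fun n => LinearMap.ext fun ψ => h n ψ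

theorem separating_ev :
    Separating (fun X : ℕ × (ℕ → ℕ → F) => ev X.1 X.2) := by
  intro a a' h
  have hc : ∀ p x, ev p x = (LinearMap.proj (UT.ofFun p x) ∘ₗ (scf (utCl F p)).subtype) ∘ₗ
      (DirectSum.component ℂ ℕ (UPiece F) p : ScfUT F →ₗ[ℂ] scf (utCl F p)) := by
    intro p x
    refine linearMap_ext fun n ψ => ?_
    rw [ev_incl]
    split_ifs with hn
    · subst hn
      exact congrArg (fun φ : scf (utCl F n) => φ.1 (UT.ofFun n x))
        (DirectSum.component.lof_self ℂ (M := UPiece F) n ψ).symm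
    · have : (DirectSum.component ℂ ℕ (UPiece F) p : ScfUT F →ₗ[ℂ] scf (utCl F p)) (incl F n ψ)
          = 0 := DFinsupp.single_eq_of_ne (Ne.symm hn)
      exact (congrArg (fun φ : scf (utCl F p) => φ.1 (UT.ofFun p x)) this).symm
  refine DFinsupp.ext (β := UPiece F) fun p => Subtype.ext (funext fun u => ?_)
  obtain ⟨x, rfl⟩ := u.exists_ofFun
  have := h (p, x)
  simp only [hc] at this
  exact this

theorem induction {P : ScfUT F → Prop} (h0 : P 0) (h1 : ∀ n ψ, P (incl F n ψ))
    (h2 : ∀ a b, P a → P b → P (a + b)) (a : ScfUT F) : P a :=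
  DirectSum.induction_on (β := UPiece F) a h0 h1 h2

end ScfUT

/-! ### Shuffles of matrices -/

open Classical in
/-- The number of elements of `A` below `i`. -/
def rank (A : Set ℕ) (i : ℕ) : ℕ := Nat.count (· ∈ A) i

theorem rank_zero (A : Set ℕ) : rank A 0 = 0 := by
  classical exact Nat.count_zero _

theorem rank_succ_of_mem {A : Set ℕ} {i : ℕ} (h : i ∈ A) : rank A (i + 1) = rank A i + 1 := by
  rw [rank, Nat.count_succ, if_pos h, rank]

theorem rank_succ_of_notMem {A : Set ℕ} {i : ℕ} (h : i ∉ A) : rank A (i + 1) = rank A i := by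
  rw [rank, Nat.count_succ, if_neg h, rank, add_zero]

open Classical in
/-- The matrix with the entries of `x` in the rows and columns of `A`, the entries of `y` in
the rows and columns of `Aᶜ` (in order), and `0` elsewhere. -/
def shuffleFun (A : Set ℕ) (x y : ℕ → ℕ → F) (i j : ℕ) : F :=
  if i ∈ A ∧ j ∈ A then x (rank A i) (rank A j)
  else if i ∉ A ∧ j ∉ A then y (rank Aᶜ i) (rank Aᶜ j) else 0

/-- The `l`-th element of `A` in increasing order has exactly `l` elements of `A` below it. -/
theorem rank_orderEmbOfFin {n k : ℕ} (A : Finset (Fin n)) (hk : A.card = k) (S : Set ℕ)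
    (hS : ∀ i : Fin n, i.val ∈ S ↔ i ∈ A) (l : Fin k) :
    rank S (A.orderEmbOfFin hk l) = l := by
  classical
  rw [rank, Nat.count_eq_card_filter_range]
  have : {j ∈ Finset.range (A.orderEmbOfFin hk l) | j ∈ S}
      = (Finset.Iio l).map ((A.orderEmbOfFin hk).toEmbedding.trans Fin.valEmbedding) := by
    ext j
    simp only [Finset.mem_filter, Finset.mem_range, Finset.mem_map, Finset.mem_Iio,
      Function.Embedding.trans_apply, Fin.valEmbedding_apply, RelEmbedding.coe_toEmbedding]
    constructor
    · rintro ⟨h1, h2⟩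
      have hj : j < n := h1.trans (A.orderEmbOfFin hk l).2
      have hA : (⟨j, hj⟩ : Fin n) ∈ A := (hS ⟨j, hj⟩).mp h2
      have : (⟨j, hj⟩ : Fin n) ∈ Set.range (A.orderEmbOfFin hk) := by
        rw [Finset.range_orderEmbOfFin]; exact hA
      obtain ⟨m, hm⟩ := this
      refine ⟨m, ?_, congrArg Fin.val hm⟩
      rw [← (A.orderEmbOfFin hk).lt_iff_lt, hm]
      exact h1
    · rintro ⟨m, hm, rfl⟩
      exact ⟨(A.orderEmbOfFin hk).lt_iff_lt.mpr hm, (hS _).mpr (A.orderEmbOfFin_mem hk m)⟩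
  rw [this, Finset.card_map, Fin.card_Iio]

/-- The embedding of `UT_{|A|} × UT_{|Aᶜ|}` into `UT_n` in terms of matrices given by functions on
`ℕ × ℕ`. -/
theorem shuffleUT_ofFun {n : ℕ} (A : Finset (Fin n)) (S : Set ℕ)
    (hS : ∀ i : Fin n, i.val ∈ S ↔ i ∈ A) (x y : ℕ → ℕ → F) :
    shuffleUT A (UT.ofFun A.card x, UT.ofFun Aᶜ.card y) = UT.ofFun n (shuffleFun S x y) := by
  have hS' : ∀ i : Fin n, i.val ∈ Sᶜ ↔ i ∈ Aᶜ := by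
    intro i
    rw [Set.mem_compl_iff, hS, Finset.mem_compl]
  refine UT.ext_of_lt fun i j hij => ?_
  rw [UT.ofFun_apply, if_pos hij]
  obtain ⟨i, rfl⟩ := (finSumEquivOfFinset (s := A) rfl rfl).surjective i
  obtain ⟨j, rfl⟩ := (finSumEquivOfFinset (s := A) rfl rfl).surjective j
  simp only [shuffleUT, shuffleMat, Matrix.reindex_apply, Matrix.submatrix_apply,
    Equiv.symm_apply_apply]
  have hl : ∀ k : Fin A.card, ((finSumEquivOfFinset (s := A) rfl rfl (Sum.inl k) : Fin n) : ℕ) ∈ S :=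
    fun k => (hS _).mpr (by rw [finSumEquivOfFinset_inl]; exact A.orderEmbOfFin_mem rfl k)
  have hr : ∀ k : Fin Aᶜ.card,
      ((finSumEquivOfFinset (s := A) rfl rfl (Sum.inr k) : Fin n) : ℕ) ∉ S :=
    fun k => (hS' _).mpr (by rw [finSumEquivOfFinset_inr]; exact Aᶜ.orderEmbOfFin_mem rfl k)
  rcases i with i | i <;> rcases j with j | j
  · rw [shuffleFun, if_pos ⟨hl i, hl j⟩]
    simp only [finSumEquivOfFinset_inl, rank_orderEmbOfFin A rfl S hS, Matrix.fromBlocks_apply₁₁,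
      UT.ofFun_apply]
    rw [if_pos]
    simpa using hij
  · rw [shuffleFun, if_neg (fun h => hr j h.2), if_neg (fun h => h.1 (hl i))]
    rfl
  · rw [shuffleFun, if_neg (fun h => hr i h.1), if_neg (fun h => h.2 (hl j))]
    rfl
  · rw [shuffleFun, if_neg (fun h => hr i h.1), if_pos ⟨hr i, hr j⟩]
    simp only [finSumEquivOfFinset_inr, rank_orderEmbOfFin Aᶜ rfl Sᶜ hS', Matrix.fromBlocks_apply₂₂,
      UT.ofFun_apply]
    rw [if_pos]
    simpa using hij

/-! ### Values of products and coproducts -/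

/-- Sums over the subsets of `{0, …, n-1}`, as subsets of `Fin n` and as subsets of `ℕ`. -/
theorem sum_finset_fin {n : ℕ} (f : Finset ℕ → ℂ) :
    ∑ A : Finset (Fin n), f (A.map Fin.valEmbedding) = ∑ A ∈ (Finset.range n).powerset, f A := by
  refine Finset.sum_bij (fun A _ => A.map Fin.valEmbedding) ?_ ?_ ?_ ?_
  · intro A _
    rw [Finset.mem_powerset]
    intro i hi
    obtain ⟨j, _, rfl⟩ := Finset.mem_map.mp hi
    exact Finset.mem_range.mpr j.2
  · intro A _ B _ h
    exact Finset.map_injective _ h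
  · intro B hB
    have hB' : ∀ i ∈ B, i < n := fun i hi => Finset.mem_range.mp (Finset.mem_powerset.mp hB hi)
    refine ⟨B.attachFin hB', Finset.mem_univ _, ?_⟩
    exact Finset.map_valEmbedding_attachFin hB'
  · intro A _
    rfl

/-- The matrix without its first `k` rows and columns. -/
def shift (k : ℕ) (x : ℕ → ℕ → F) (i j : ℕ) : F := x (k + i) (k + j)

theorem UT.block_castAdd_ofFun (m n : ℕ) (x : ℕ → ℕ → F) :
    (UT.ofFun (m + n) x).block (Fin.castAddOrderEmb n) = UT.ofFun m x := by
  refine UT.ext_of_lt fun i j hij => ?_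
  rw [UT.ofFun_apply, if_pos hij]
  exact if_pos hij

theorem UT.block_natAdd_ofFun (m n : ℕ) (x : ℕ → ℕ → F) :
    (UT.ofFun (m + n) x).block (Fin.natAddOrderEmb m) = UT.ofFun n (shift m x) := by
  refine UT.ext_of_lt fun i j hij => ?_
  rw [UT.ofFun_apply, if_pos hij]
  exact if_pos ((Fin.natAddOrderEmb m).lt_iff_lt.mpr hij)

namespace ScfUT

/-- `ev p x ⊗ ev q y` on the component of degree `(a, b)`. -/
theorem tmulFunctional_ev_map_incl (p q : ℕ) (x y : ℕ → ℕ → F) (a b : ℕ)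
    (t : scf (utCl F a) ⊗[ℂ] scf (utCl F b)) :
    tmulFunctional (ev p x) (ev q y) (TensorProduct.map (incl F a) (incl F b) t)
      = if a = p ∧ b = q then scf.evalTensor _ _ (UT.ofFun a x) (UT.ofFun b y) t else 0 := by
  induction t with
  | zero => simp
  | add t t' h h' =>
    simp only [map_add, h, h']
    split_ifs <;> simp
  | tmul φ γ =>
    simp only [TensorProduct.map_tmul, tmulFunctional_tmul, ev_incl, ite_and]
    split_ifs <;> simp [scf.evalTensor]

theorem incl_mul_incl (m n : ℕ) (ψ : scf (utCl F m)) (γ : scf (utCl F n)) :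
    incl F m ψ * incl F n γ = incl F (m + n) (mulUPiece ψ γ) :=
  DirectSum.of_mul_of (A := UPiece F) ψ γ

/-- Evaluating a product at `x` splits `x` into two diagonal blocks in all possible ways; in each
degree at most one of them contributes. -/
theorem ev_mul (p : ℕ) (x : ℕ → ℕ → F) (a b : ScfUT F) :
    ev p x (a * b)
      = ∑ k ∈ Finset.HasAntidiagonal.antidiagonal p, ev k.1 x a * ev k.2 (shift k.1 x) b := by
  induction a using ScfUT.induction with
  | h0 => simp
  | h2 a a' h h' => simp only [add_mul, map_add, h, h', Finset.sum_add_distrib]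
  | h1 m ψ =>
    induction b using ScfUT.induction with
    | h0 => simp
    | h2 a a' h h' => simp only [mul_add, map_add, h, h', Finset.sum_add_distrib]
    | h1 n γ =>
      have h1 : ev p x (incl F m ψ * incl F n γ) = if m + n = p then
          (mulUPiece (m := m) (n := n) ψ γ).1 (UT.ofFun (m + n) x) else 0 :=
        (congrArg (ev p x) (incl_mul_incl m n ψ γ)).trans (ev_incl p x (m + n) _)
      rw [h1]
      simp only [ev_incl]
      by_cases hp : m + n = p
      · rw [if_pos hp, Finset.sum_eq_single (m, n)]
        · simp only [if_true]
          exact congrArg₂ (· * ·) (congrArg ψ.1 (UT.block_castAdd_ofFun m n x))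
            (congrArg γ.1 (UT.block_natAdd_ofFun m n x))
        · rintro ⟨k, l⟩ - hkl
          by_cases h1 : m = k
          · rw [if_neg (show n ≠ l from fun h2 => hkl (by rw [h1, h2])), mul_zero]
          · rw [if_neg h1, zero_mul]
        · intro h
          exact absurd (Finset.HasAntidiagonal.mem_antidiagonal.mpr hp) h
      · rw [if_neg hp, Finset.sum_eq_zero]
        rintro ⟨k, l⟩ hkl
        have := Finset.HasAntidiagonal.mem_antidiagonal.mp hkl
        by_cases h1 : m = k
        · rw [if_neg (show n ≠ l from fun h2 => hp (by rw [h1, h2]; exact this)), mul_zero]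
        · rw [if_neg h1, zero_mul]

variable [Fintype F]

theorem comul_incl (n : ℕ) (ψ : scf (utCl F n)) :
    CoalgebraStruct.comul (R := ℂ) (incl F n ψ) = ∑ A : Finset (Fin n),
      TensorProduct.map (incl F A.card) (incl F Aᶜ.card) (scf.toTensor _ _ (resUT A ψ)) := by
  refine (lift_incl F _ n ψ).trans ?_
  simp

theorem counit_incl (n : ℕ) (ψ : scf (utCl F n)) :
    CoalgebraStruct.counit (R := ℂ) (incl F n ψ) = if n = 0 then ψ.1 1 else 0 := by
  refine (lift_incl F _ n ψ).trans ?_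
  split_ifs <;> rfl

/-- The coproduct is dual to shuffling: evaluating it at `(x, y)` is evaluating the argument at all
shuffles of `x` and `y`. -/
theorem tmulFunctional_comul (p q : ℕ) (x y : ℕ → ℕ → F) (a : ScfUT F) :
    tmulFunctional (ev p x) (ev q y) (CoalgebraStruct.comul (R := ℂ) a)
      = ∑ A ∈ (Finset.range (p + q)).powersetCard p, ev (p + q) (shuffleFun (A : Set ℕ) x y) a := by
  induction a using ScfUT.induction with
  | h0 => simp
  | h2 a b ha hb => simp only [map_add, ha, hb, Finset.sum_add_distrib]
  | h1 n ψ =>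
    have h1 : ∀ A : Finset (Fin n), tmulFunctional (ev p x) (ev q y)
        (TensorProduct.map (incl F A.card) (incl F Aᶜ.card) (scf.toTensor _ _ (resUT A ψ)))
        = if (A.map Fin.valEmbedding).card = p ∧ n = p + q then
          ψ.1 (UT.ofFun n (shuffleFun ((A.map Fin.valEmbedding : Finset ℕ) : Set ℕ) x y)) else 0 := by
      intro A
      rw [tmulFunctional_ev_map_incl, scf.evalTensor_toTensor]
      have hc : A.card = p ∧ Aᶜ.card = q ↔ (A.map Fin.valEmbedding).card = p ∧ n = p + q := by
        have := A.card_add_card_compl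
        rw [Fintype.card_fin] at this
        rw [Finset.card_map]
        omega
      simp only [hc]
      congr 1
      refine congrArg ψ.1 (shuffleUT_ofFun A _ ?_ x y)
      intro i
      simp [Fin.val_inj]
    simp only [comul_incl, map_sum, h1, ev_incl]
    rw [sum_finset_fin (fun A => if A.card = p ∧ n = p + q then
      ψ.1 (UT.ofFun n (shuffleFun (A : Set ℕ) x y)) else 0)]
    by_cases hn : n = p + q
    · subst hn
      simp only [and_true, if_true, ← Finset.sum_filter]
      refine Finset.sum_congr ?_ fun _ _ => rfl
      ext A
      simp [Finset.mem_powersetCard]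
    · simp [hn]

theorem counit_eq_ev (x : ℕ → ℕ → F) :
    (CoalgebraStruct.counit : ScfUT F →ₗ[ℂ] ℂ) = ev 0 x := by
  refine linearMap_ext fun n ψ => ?_
  rw [counit_incl, ev_incl]
  split_ifs with h
  · subst h
    exact congrArg ψ.1 (Subsingleton.elim _ _)
  · rfl

end ScfUT

end Evaluation

/-! ### Ranks and nested subsets -/

theorem rank_add_rank_compl (S : Set ℕ) (n : ℕ) : rank S n + rank Sᶜ n = n := by
  induction n with
  | zero => simp [rank_zero]
  | succ n ih =>
    by_cases h : n ∈ S
    · rw [rank_succ_of_mem h, rank_succ_of_notMem (by simpa using h)]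
      omega
    · rw [rank_succ_of_notMem h, rank_succ_of_mem (by simpa using h)]
      omega

theorem rank_congr {S T : Set ℕ} {n : ℕ} (h : ∀ i < n, i ∈ S ↔ i ∈ T) : rank S n = rank T n := by
  induction n with
  | zero => simp [rank_zero]
  | succ n ih =>
    have ih := ih fun i hi => h i (hi.trans (Nat.lt_succ_self n))
    have hn := h n (Nat.lt_succ_self n)
    by_cases hS : n ∈ S
    · rw [rank_succ_of_mem hS, rank_succ_of_mem (hn.mp hS), ih]
    · rw [rank_succ_of_notMem hS, rank_succ_of_notMem (fun h => hS (hn.mpr h)), ih]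

theorem rank_add (S : Set ℕ) (m i : ℕ) : rank S (m + i) = rank S m + rank {j | m + j ∈ S} i := by
  classical
  simp only [rank]
  rw [Nat.count_add]
  simp only [Set.mem_ofPred_eq]

theorem rank_coe_finset {A : Finset ℕ} {n : ℕ} (h : A ⊆ Finset.range n) :
    rank (A : Set ℕ) n = A.card := by
  classical
  rw [rank, Nat.count_eq_card_filter_range]
  congr 1
  ext i
  simp only [Finset.mem_filter, Finset.mem_coe]
  exact ⟨fun hi => hi.2, fun hi => ⟨h hi, hi⟩⟩

theorem rank_lt_rank {S : Set ℕ} {i j : ℕ} (hi : i ∈ S) (h : i < j) : rank S i < rank S j := by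
  classical exact Nat.count_strict_mono hi h

theorem rank_injOn (S : Set ℕ) : Set.InjOn (rank S) S := by
  intro i hi j hj h
  rcases lt_trichotomy i j with h' | h' | h'
  · exact absurd h (rank_lt_rank hi h').ne
  · exact h'
  · exact absurd h (rank_lt_rank hj h').ne'

theorem lt_of_rank_lt_rank {S : Set ℕ} {i j : ℕ} (h : rank S i < rank S j) : i < j := by
  classical exact Nat.lt_of_count_lt_count h

theorem exists_rank_eq {S : Set ℕ} {n a : ℕ} (h : a < rank S n) : ∃ i < n, i ∈ S ∧ rank S i = a := by
  induction n with
  | zero => simp [rank_zero] at h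
  | succ n ih =>
    by_cases hn : n ∈ S
    · rw [rank_succ_of_mem hn] at h
      rcases (Nat.lt_succ_iff.mp h).eq_or_lt with h | h
      · exact ⟨n, Nat.lt_succ_self n, hn, h.symm⟩
      · obtain ⟨i, h1, h2⟩ := ih h
        exact ⟨i, h1.trans (Nat.lt_succ_self n), h2⟩
    · rw [rank_succ_of_notMem hn] at h
      obtain ⟨i, h1, h2⟩ := ih h
      exact ⟨i, h1.trans (Nat.lt_succ_self n), h2⟩

/-- The subset of `S` that corresponds to `A` when the elements of `S` are numbered in increasing
order. -/
def nest (S A : Set ℕ) : Set ℕ := {i | i ∈ S ∧ rank S i ∈ A}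

theorem mem_nest {S A : Set ℕ} {i : ℕ} : i ∈ nest S A ↔ i ∈ S ∧ rank S i ∈ A := Iff.rfl

/-- Numbering first by `S` and then by `A` is numbering by `nest S A`. -/
theorem rank_rank (S A : Set ℕ) (i : ℕ) : rank A (rank S i) = rank (nest S A) i := by
  induction i with
  | zero => simp [rank_zero]
  | succ i ih =>
    by_cases h : i ∈ S
    · rw [rank_succ_of_mem h]
      by_cases h' : rank S i ∈ A
      · rw [rank_succ_of_mem h', rank_succ_of_mem (show i ∈ nest S A from ⟨h, h'⟩), ih]
      · rw [rank_succ_of_notMem h', rank_succ_of_notMem (fun h2 : i ∈ nest S A => h' h2.2), ih]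
    · rw [rank_succ_of_notMem h, rank_succ_of_notMem (fun h2 : i ∈ nest S A => h h2.1), ih]

theorem nest_compl (S A : Set ℕ) : nest S Aᶜ = S \ nest S A := by
  ext i
  simp only [nest, Set.mem_ofPred_eq, Set.mem_compl_iff, Set.mem_sdiff]
  tauto

open Classical in
/-- The `k`-subsets of `S ∩ {0, …, n-1}` correspond to the `k`-subsets of `{0, …, r-1}`,
where `r` is the number of elements of `S` below `n`. -/
theorem sum_nest {M : Type*} [AddCommMonoid M] (S : Set ℕ) (n k : ℕ) (f : Set ℕ → M) :
    ∑ A ∈ (Finset.range (rank S n)).powersetCard k, f (nest S A)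
      = ∑ P ∈ ({i ∈ Finset.range n | i ∈ S} : Finset ℕ).powersetCard k, f P := by
  have hcoe : ∀ A ∈ (Finset.range (rank S n)).powersetCard k,
      (({i ∈ Finset.range n | i ∈ nest S A} : Finset ℕ) : Set ℕ) = nest S A := by
    intro A hA
    ext i
    simp only [Finset.coe_filter, Finset.mem_range, Set.mem_ofPred_eq, and_iff_right_iff_imp]
    intro hi
    exact lt_of_rank_lt_rank (Finset.mem_range.mp ((Finset.mem_powersetCard.mp hA).1 hi.2))
  refine Finset.sum_bij (fun A _ => {i ∈ Finset.range n | i ∈ nest S A}) ?_ ?_ ?_ ?_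
  · intro A hA
    have hA' := Finset.mem_powersetCard.mp hA
    rw [Finset.mem_powersetCard]
    refine ⟨fun i hi => ?_, ?_⟩
    · simp only [Finset.mem_filter] at hi ⊢
      exact ⟨hi.1, hi.2.1⟩
    · rw [← rank_coe_finset (n := n) (Finset.filter_subset _ _), hcoe A hA, ← rank_rank,
        rank_coe_finset hA'.1, hA'.2]
  · intro A hA B hB h
    have h' : nest S A = nest S B := by rw [← hcoe A hA, ← hcoe B hB, h]
    have key : ∀ A B : Finset ℕ, A ⊆ Finset.range (rank S n) → nest S A = nest S B → A ⊆ B := by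
      intro A B hA h a ha
      obtain ⟨i, _, hi, rfl⟩ := exists_rank_eq (Finset.mem_range.mp (hA ha))
      have : i ∈ nest S (B : Set ℕ) := by rw [← h]; exact ⟨hi, ha⟩
      exact this.2
    exact (key A B (Finset.mem_powersetCard.mp hA).1 h').antisymm
      (key B A (Finset.mem_powersetCard.mp hB).1 h'.symm)
  · intro P hP
    obtain ⟨hP, hk⟩ := Finset.mem_powersetCard.mp hP
    have hS : ∀ i ∈ P, i < n ∧ i ∈ S := fun i hi => by simpa using hP hi
    have hinj : Set.InjOn (rank S) P := (rank_injOn S).mono fun i hi => (hS i hi).2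
    refine ⟨P.image (rank S), ?_, ?_⟩
    · rw [Finset.mem_powersetCard, Finset.card_image_of_injOn hinj]
      refine ⟨fun a ha => ?_, hk⟩
      obtain ⟨i, hi, rfl⟩ := Finset.mem_image.mp ha
      exact Finset.mem_range.mpr (rank_lt_rank (hS i hi).2 (hS i hi).1)
    · ext i
      simp only [Finset.mem_filter, Finset.mem_range, nest, Set.mem_ofPred_eq, Finset.coe_image,
        Set.mem_image, Finset.mem_coe]
      constructor
      · rintro ⟨_, hi, j, hj, hij⟩
        rwa [← rank_injOn S (hS j hj).2 hi hij]
      · intro hi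
        exact ⟨(hS i hi).1, (hS i hi).2, i, hi, rfl⟩
  · intro A hA
    rw [hcoe A hA]

/-- A set `B` with a distinguished part `P` is the same as a pair of disjoint sets `P` and `Q = B \ P`. -/
theorem sum_powersetCard_powersetCard {M : Type*} [AddCommMonoid M] (R : Finset ℕ) (p q : ℕ)
    (f : Finset ℕ → Finset ℕ → M) :
    ∑ B ∈ R.powersetCard (p + q), ∑ P ∈ B.powersetCard p, f P B
      = ∑ P ∈ R.powersetCard p, ∑ Q ∈ (R \ P).powersetCard q, f P (P ∪ Q) := by
  rw [Finset.sum_comm' (t' := R.powersetCard p)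
    (s' := fun P => {B ∈ R.powersetCard (p + q) | P ⊆ B})]
  · refine Finset.sum_congr rfl fun P hP => ?_
    obtain ⟨hPR, hp⟩ := Finset.mem_powersetCard.mp hP
    refine Finset.sum_nbij' (fun B => B \ P) (fun Q => P ∪ Q) ?_ ?_ ?_ ?_ ?_
    · intro B hB
      simp only [Finset.mem_filter, Finset.mem_powersetCard] at hB ⊢
      refine ⟨Finset.sdiff_subset_sdiff hB.1.1 le_rfl, ?_⟩
      rw [Finset.card_sdiff_of_subset hB.2]
      omega
    · intro Q hQ
      simp only [Finset.mem_filter, Finset.mem_powersetCard] at hQ ⊢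
      refine ⟨⟨Finset.union_subset hPR (hQ.1.trans Finset.sdiff_subset), ?_⟩,
        Finset.subset_union_left⟩
      rw [Finset.card_union_of_disjoint, hp, hQ.2]
      exact Finset.disjoint_of_subset_right hQ.1 Finset.disjoint_sdiff
    · intro B hB
      exact Finset.union_sdiff_of_subset (Finset.mem_filter.mp hB).2
    · intro Q hQ
      have : Disjoint P Q := Finset.disjoint_of_subset_right (Finset.mem_powersetCard.mp hQ).1
        Finset.disjoint_sdiff
      exact Finset.union_sdiff_cancel_left this
    · intro B hB
      rw [Finset.union_sdiff_of_subset (Finset.mem_filter.mp hB).2]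
  · intro B P
    simp only [Finset.mem_filter, Finset.mem_powersetCard]
    constructor
    · rintro ⟨⟨h1, h2⟩, h3, h4⟩
      exact ⟨⟨⟨h1, h2⟩, h3⟩, h3.trans h1, h4⟩
    · rintro ⟨⟨⟨h1, h2⟩, h3⟩, h4, h5⟩
      exact ⟨⟨h1, h2⟩, h3, h5⟩

section Shuffle

variable {F : Type*} [Field F]

open Classical in
/-- The analogue of `shuffleFun` for three sets of rows and columns. -/
def shuffleFun₃ (P Q R : Set ℕ) (x y z : ℕ → ℕ → F) (i j : ℕ) : F :=
  if i ∈ P ∧ j ∈ P then x (rank P i) (rank P j)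
  else if i ∈ Q ∧ j ∈ Q then y (rank Q i) (rank Q j)
  else if i ∈ R ∧ j ∈ R then z (rank R i) (rank R j) else 0

/-- An iterated shuffle is a shuffle of three matrices. -/
theorem shuffleFun_left (B A : Set ℕ) (x y z : ℕ → ℕ → F) :
    shuffleFun B (shuffleFun A x y) z
      = shuffleFun₃ (nest B A) (B \ nest B A) Bᶜ x y z := by
  rw [← nest_compl]
  funext i j
  simp only [shuffleFun, shuffleFun₃, rank_rank]
  split_ifs <;> first
    | rfl
    | (simp only [mem_nest, Set.mem_compl_iff] at *; exfalso; tauto)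

/-- An iterated shuffle is a shuffle of three matrices. -/
theorem shuffleFun_right (B A : Set ℕ) (x y z : ℕ → ℕ → F) :
    shuffleFun B x (shuffleFun A y z)
      = shuffleFun₃ B (nest Bᶜ A) (Bᶜ \ nest Bᶜ A) x y z := by
  rw [← nest_compl]
  funext i j
  simp only [shuffleFun, shuffleFun₃, rank_rank]
  split_ifs <;> first
    | rfl
    | (simp only [mem_nest, Set.mem_compl_iff] at *; exfalso; tauto)

theorem shuffleFun_empty (x y : ℕ → ℕ → F) : shuffleFun ∅ x y = y := by
  have h : ∀ i, rank (∅ : Set ℕ)ᶜ i = i := by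
    intro i
    induction i with
    | zero => exact rank_zero _
    | succ i ih => rw [rank_succ_of_mem (by simp), ih]
  funext i j
  rw [shuffleFun, if_neg (fun h => h.1), if_pos ⟨fun h => h, fun h => h⟩, h, h]

theorem shuffleFun_range {q : ℕ} (x y : ℕ → ℕ → F) {i j : ℕ} (hi : i < q) (hj : j < q) :
    shuffleFun (Finset.range q : Set ℕ) x y i j = x i j := by
  have h : ∀ i ≤ q, rank (Finset.range q : Set ℕ) i = i := by
    intro i
    induction i with
    | zero => exact fun _ => rank_zero _
    | succ i ih =>
      intro hi
      rw [rank_succ_of_mem (by simpa using hi), ih (by omega)]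
  rw [shuffleFun, if_pos (by simp [hi, hj]), h i hi.le, h j hj.le]

theorem shuffleFun_union_of_lt {B C : Finset ℕ} {m : ℕ} (x y : ℕ → ℕ → F) {i j : ℕ} (hi : i < m)
    (hj : j < m) :
    shuffleFun (B ∪ C.map (addLeftEmbedding m) : Finset ℕ) x y i j
      = shuffleFun (B : Set ℕ) x y i j := by
  have hmem : ∀ k < m, k ∈ ((B ∪ C.map (addLeftEmbedding m) : Finset ℕ) : Set ℕ) ↔
      k ∈ (B : Set ℕ) := by
    intro k hk
    simp only [Finset.coe_union, Set.mem_union, Finset.mem_coe, Finset.mem_map,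
      addLeftEmbedding_apply, or_iff_left_iff_imp]
    rintro ⟨c, _, rfl⟩
    omega
  have h1 : ∀ k < m, rank ((B ∪ C.map (addLeftEmbedding m) : Finset ℕ) : Set ℕ) k
      = rank (B : Set ℕ) k := fun k hk => rank_congr fun l hl => hmem l (hl.trans hk)
  have h2 : ∀ k < m, rank ((B ∪ C.map (addLeftEmbedding m) : Finset ℕ) : Set ℕ)ᶜ k
      = rank (B : Set ℕ)ᶜ k := fun k hk => rank_congr fun l hl =>
        not_congr (hmem l (hl.trans hk))
  simp only [shuffleFun, hmem i hi, hmem j hj, h1 i hi, h1 j hj, h2 i hi, h2 j hj]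
  congr

/-- Without the first `m` rows and columns, a shuffle of `x` and `y` is a shuffle of the remaining parts
of `x` and `y`: its first `m` rows use up `|B|` rows of `x` and `m - |B|` rows of `y`. -/
theorem shift_shuffleFun_union {B C : Finset ℕ} {m : ℕ} (hB : B ⊆ Finset.range m)
    (x y : ℕ → ℕ → F) :
    shift m (shuffleFun (B ∪ C.map (addLeftEmbedding m) : Finset ℕ) x y)
      = shuffleFun (C : Set ℕ) (shift B.card x) (shift (m - B.card) y) := by
  set D : Set ℕ := ((B ∪ C.map (addLeftEmbedding m) : Finset ℕ) : Set ℕ) with hD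
  have hmem : ∀ k, m + k ∈ D ↔ k ∈ (C : Set ℕ) := by
    intro k
    have : m + k ∉ B := fun h => by simpa using hB h
    simp [hD, this]
  have hlow : ∀ k < m, k ∈ D ↔ k ∈ (B : Set ℕ) := by
    intro k hk
    simp only [hD, Finset.coe_union, Set.mem_union, Finset.mem_coe, Finset.mem_map,
      addLeftEmbedding_apply, or_iff_left_iff_imp]
    rintro ⟨c, _, rfl⟩
    omega
  have h1 : ∀ k, rank D (m + k) = B.card + rank (C : Set ℕ) k := by
    intro k
    rw [rank_add, rank_congr hlow, rank_coe_finset hB]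
    congr 2
    ext j
    exact hmem j
  have h2 : ∀ k, rank Dᶜ (m + k) = (m - B.card) + rank (C : Set ℕ)ᶜ k := by
    intro k
    have e1 := rank_add_rank_compl D (m + k)
    have e2 := rank_add_rank_compl (C : Set ℕ) k
    have e3 := Finset.card_le_card hB
    rw [Finset.card_range] at e3
    rw [h1] at e1
    omega
  funext i j
  simp only [shift, shuffleFun, hmem, h1, h2]
  congr

end Shuffle

/-- A subset of `{0, …, m+n-1}` is a subset `B` of `{0, …, m-1}` together with the translate of a subset
`C` of `{0, …, n-1}`. -/
theorem sum_powerset_range_add {M : Type*} [AddCommMonoid M] (m n : ℕ) (f : Finset ℕ → M) :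
    ∑ A ∈ (Finset.range (m + n)).powerset, f A = ∑ B ∈ (Finset.range m).powerset,
      ∑ C ∈ (Finset.range n).powerset, f (B ∪ C.map (addLeftEmbedding m)) := by
  rw [← Finset.sum_product']
  refine Finset.sum_nbij' (fun A => ({i ∈ A | i < m}, {i ∈ Finset.range n | m + i ∈ A}))
    (fun P => P.1 ∪ P.2.map (addLeftEmbedding m)) ?_ ?_ ?_ ?_ ?_
  · intro A _
    simp only [Finset.mem_product, Finset.mem_powerset]
    refine ⟨fun i hi => ?_, Finset.filter_subset _ _⟩
    exact Finset.mem_range.mpr (Finset.mem_filter.mp hi).2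
  · rintro ⟨B, C⟩ h
    simp only [Finset.mem_product, Finset.mem_powerset] at h ⊢
    intro i hi
    simp only [Finset.mem_union, Finset.mem_map, addLeftEmbedding_apply] at hi
    rw [Finset.mem_range]
    rcases hi with hi | ⟨c, hc, rfl⟩
    · have := Finset.mem_range.mp (h.1 hi)
      omega
    · have := Finset.mem_range.mp (h.2 hc)
      omega
  · intro A hA
    ext i
    simp only [Finset.mem_union, Finset.mem_filter, Finset.mem_map, addLeftEmbedding_apply,
      Finset.mem_range]
    constructor
    · rintro (h | ⟨c, h, rfl⟩)
      · exact h.1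
      · exact h.2
    · intro hi
      have := Finset.mem_range.mp (Finset.mem_powerset.mp hA hi)
      rcases lt_or_ge i m with h | h
      · exact Or.inl ⟨hi, h⟩
      · exact Or.inr ⟨i - m, ⟨by omega, by rwa [Nat.add_sub_cancel' h]⟩, by omega⟩
  · rintro ⟨B, C⟩ h
    simp only [Finset.mem_product, Finset.mem_powerset] at h
    have hB : ∀ i ∈ B, i < m := fun i hi => Finset.mem_range.mp (h.1 hi)
    have hC : ∀ i ∈ C, i < n := fun i hi => Finset.mem_range.mp (h.2 hi)
    ext i
    · simp only [Finset.mem_filter, Finset.mem_union, Finset.mem_map, addLeftEmbedding_apply]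
      constructor
      · rintro ⟨h | ⟨c, _, rfl⟩, h'⟩
        · exact h
        · omega
      · exact fun h => ⟨Or.inl h, hB i h⟩
    · simp only [Finset.mem_filter, Finset.mem_union, Finset.mem_map, addLeftEmbedding_apply,
        Finset.mem_range, add_right_inj, exists_eq_right]
      constructor
      · rintro ⟨_, h | h⟩
        · have := hB _ h
          omega
        · exact h
      · exact fun h => ⟨hC i h, Or.inr h⟩
  · intro A hA
    congr 1
    ext i
    simp only [Finset.mem_union, Finset.mem_filter, Finset.mem_map, addLeftEmbedding_apply,
      Finset.mem_range]
    constructor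
    · intro hi
      have := Finset.mem_range.mp (Finset.mem_powerset.mp hA hi)
      rcases lt_or_ge i m with h | h
      · exact Or.inl ⟨hi, h⟩
      · exact Or.inr ⟨i - m, ⟨by omega, by rwa [Nat.add_sub_cancel' h]⟩, by omega⟩
    · rintro (h | ⟨c, h, rfl⟩)
      · exact h.1
      · exact h.2

/-! ### The Hopf algebra of superclass functions of unipotent groups -/

section FunctionalsComul

variable {M N N' : Type*} [AddCommMonoid M] [AddCommMonoid N] [AddCommMonoid N'] [Module ℂ M]
  [Module ℂ N] [Module ℂ N']

theorem tmulFunctional_map_left (f : N →ₗ[ℂ] ℂ) (g : N' →ₗ[ℂ] ℂ) (h : M →ₗ[ℂ] N) (t : M ⊗[ℂ] N') :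
    tmulFunctional f g (h.rTensor N' t) = tmulFunctional (f ∘ₗ h) g t := by
  refine LinearMap.congr_fun (f := tmulFunctional f g ∘ₗ h.rTensor N') ?_ t
  ext
  rfl

theorem tmulFunctional_map_right (f : N' →ₗ[ℂ] ℂ) (g : N →ₗ[ℂ] ℂ) (h : M →ₗ[ℂ] N)
    (t : N' ⊗[ℂ] M) : tmulFunctional f g (h.lTensor N' t) = tmulFunctional f (g ∘ₗ h) t := by
  refine LinearMap.congr_fun (f := tmulFunctional f g ∘ₗ h.lTensor N') ?_ t
  ext
  rfl

theorem tmulFunctional_assoc (f : M →ₗ[ℂ] ℂ) (g : N →ₗ[ℂ] ℂ) (h : N' →ₗ[ℂ] ℂ)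
    (t : (M ⊗[ℂ] N) ⊗[ℂ] N') :
    tmulFunctional f (tmulFunctional g h) (TensorProduct.assoc ℂ M N N' t)
      = tmulFunctional (tmulFunctional f g) h t := by
  refine LinearMap.congr_fun
    (f := tmulFunctional f (tmulFunctional g h) ∘ₗ (TensorProduct.assoc ℂ M N N').toLinearMap) ?_ t
  ext
  simp [mul_assoc]

theorem tmulFunctional_sum_left {ι : Type*} (s : Finset ι) (f : ι → M →ₗ[ℂ] ℂ) (g : N →ₗ[ℂ] ℂ)
    (t : M ⊗[ℂ] N) :
    tmulFunctional (∑ i ∈ s, f i) g t = ∑ i ∈ s, tmulFunctional (f i) g t := by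
  have : tmulFunctional (∑ i ∈ s, f i) g = ∑ i ∈ s, tmulFunctional (f i) g := by
    ext
    simp [Finset.sum_mul]
  rw [this, LinearMap.sum_apply]

theorem tmulFunctional_sum_right {ι : Type*} (s : Finset ι) (f : M →ₗ[ℂ] ℂ) (g : ι → N →ₗ[ℂ] ℂ)
    (t : M ⊗[ℂ] N) :
    tmulFunctional f (∑ i ∈ s, g i) t = ∑ i ∈ s, tmulFunctional f (g i) t := by
  have : tmulFunctional f (∑ i ∈ s, g i) = ∑ i ∈ s, tmulFunctional f (g i) := by
    ext
    simp [Finset.mul_sum]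
  rw [this, LinearMap.sum_apply]

end FunctionalsComul

/-- The sums over the two antidiagonals select the unique sizes that match the given subsets. -/
theorem sum_antidiagonal_ite {p q a₁ a₂ b₁ b₂ : ℕ} (f : ℕ → ℕ → ℂ) :
    ∑ k ∈ Finset.HasAntidiagonal.antidiagonal p, ∑ l ∈ Finset.HasAntidiagonal.antidiagonal q,
      (if a₁ = k.1 ∧ b₁ = l.1 ∧ a₂ = k.2 ∧ b₂ = l.2 then f k.1 l.1 else 0)
      = if a₁ + a₂ = p ∧ b₁ + b₂ = q then f a₁ b₁ else 0 := by
  rw [← Finset.sum_product']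
  by_cases h : a₁ + a₂ = p ∧ b₁ + b₂ = q
  · rw [if_pos h, Finset.sum_eq_single ((a₁, a₂), (b₁, b₂))]
    · simp
    · rintro ⟨⟨k, k'⟩, l, l'⟩ - hne
      rw [if_neg]
      rintro ⟨h1, h2, h3, h4⟩
      dsimp only at h1 h2 h3 h4
      exact hne (by rw [h1, h2, h3, h4])
    · intro hn
      exact absurd (by simpa using h) hn
  · rw [if_neg h]
    refine Finset.sum_eq_zero ?_
    rintro ⟨⟨k, k'⟩, l, l'⟩ hkl
    rw [if_neg]
    rintro ⟨h1, h2, h3, h4⟩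
    dsimp only at h1 h2 h3 h4
    subst h1 h2 h3 h4
    exact h (by simpa using hkl)

theorem ite_and_mul {P Q R S : Prop} [Decidable P] [Decidable Q] [Decidable R] [Decidable S]
    (a b : ℂ) : (if P ∧ Q ∧ R ∧ S then a * b else 0)
      = (if P ∧ Q then a else 0) * (if R ∧ S then b else 0) := by
  by_cases P <;> by_cases Q <;> simp [*]

namespace ScfUT

variable {F : Type*} [Field F]

theorem ev_congr {p : ℕ} {x y : ℕ → ℕ → F} (h : ∀ i j, i < j → j < p → x i j = y i j)
    (a : ScfUT F) : ev p x a = ev p y a := by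
  have : ev p x = ev p y := by
    refine linearMap_ext fun n ψ => ?_
    rw [ev_incl, ev_incl]
    split_ifs with hn
    · subst hn
      rw [UT.ofFun_congr h]
    · rfl
  rw [this]

theorem one_eq_incl : (1 : ScfUT F) = incl F 0 (scf.one _) := by
  refine (DirectSum.one_def (UPiece F)).trans ?_
  exact congrArg (incl F 0) (one_smul ℂ (scf.one (utCl F 0)))

theorem ev_one (p : ℕ) (x : ℕ → ℕ → F) : ev p x (1 : ScfUT F) = if 0 = p then 1 else 0 := by
  rw [one_eq_incl, ev_incl]
  rfl

theorem tmulFunctional_ev_mul (p q : ℕ) (x y : ℕ → ℕ → F) (s t : ScfUT F ⊗[ℂ] ScfUT F) :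
    tmulFunctional (ev p x) (ev q y) (s * t)
      = ∑ k ∈ Finset.HasAntidiagonal.antidiagonal p, ∑ l ∈ Finset.HasAntidiagonal.antidiagonal q,
        tmulFunctional (ev k.1 x) (ev l.1 y) s
          * tmulFunctional (ev k.2 (shift k.1 x)) (ev l.2 (shift l.1 y)) t := by
  induction s with
  | zero => simp
  | add s s' h h' => simp only [add_mul, map_add, h, h', Finset.sum_add_distrib]
  | tmul a b =>
    induction t with
    | zero => simp
    | add s s' h h' => simp only [mul_add, map_add, h, h', Finset.sum_add_distrib]
    | tmul c d =>
      rw [Algebra.TensorProduct.tmul_mul_tmul]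
      simp only [tmulFunctional_tmul, ev_mul, Finset.sum_mul_sum]
      refine Finset.sum_congr rfl fun k _ => Finset.sum_congr rfl fun l _ => ?_
      ring

/-- Both sides are sums over all ways to divide `{0, …, p+q+r-1}` into three parts of sizes `p`,
`q` and `r`. -/
theorem sum_ev_shuffleFun (p q r : ℕ) (x y z : ℕ → ℕ → F) (a : ScfUT F) :
    ∑ A ∈ (Finset.range (p + q)).powersetCard p, ∑ B ∈ (Finset.range (p + q + r)).powersetCard (p + q),
      ev (p + q + r) (shuffleFun (B : Set ℕ) (shuffleFun (A : Set ℕ) x y) z) a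
    = ∑ A ∈ (Finset.range (q + r)).powersetCard q, ∑ B ∈ (Finset.range (p + (q + r))).powersetCard p,
      ev (p + (q + r)) (shuffleFun (B : Set ℕ) x (shuffleFun (A : Set ℕ) y z)) a := by
  classical
  rw [Finset.sum_comm, Finset.sum_comm (s := (Finset.range (q + r)).powersetCard q),
    ← add_assoc]
  simp only [shuffleFun_left, shuffleFun_right]
  have hl : ∀ B ∈ (Finset.range (p + q + r)).powersetCard (p + q),
      ∑ A ∈ (Finset.range (p + q)).powersetCard p,
        ev (p + q + r) (shuffleFun₃ (nest (B : Set ℕ) A) ((B : Set ℕ) \ nest (B : Set ℕ) A)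
          (B : Set ℕ)ᶜ x y z) a
      = ∑ P ∈ B.powersetCard p, ev (p + q + r) (shuffleFun₃ (P : Set ℕ) ((B : Set ℕ) \ (P : Set ℕ))
          (B : Set ℕ)ᶜ x y z) a := by
    intro B hB
    obtain ⟨hB, hc⟩ := Finset.mem_powersetCard.mp hB
    have := sum_nest (B : Set ℕ) (p + q + r) p
      (fun P => ev (p + q + r) (shuffleFun₃ P ((B : Set ℕ) \ P) (B : Set ℕ)ᶜ x y z) a)
    rw [rank_coe_finset hB, hc] at this
    rw [this]
    refine Finset.sum_congr (congrArg _ ?_) fun _ _ => rfl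
    ext i
    simp only [Finset.mem_filter, Finset.mem_coe]
    exact ⟨fun h => h.2, fun h => ⟨hB h, h⟩⟩
  have hr : ∀ B ∈ (Finset.range (p + q + r)).powersetCard p,
      ∑ A ∈ (Finset.range (q + r)).powersetCard q,
        ev (p + q + r) (shuffleFun₃ (B : Set ℕ) (nest (B : Set ℕ)ᶜ A)
          ((B : Set ℕ)ᶜ \ nest (B : Set ℕ)ᶜ A) x y z) a
      = ∑ Q ∈ (Finset.range (p + q + r) \ B).powersetCard q,
        ev (p + q + r) (shuffleFun₃ (B : Set ℕ) (Q : Set ℕ) ((B : Set ℕ)ᶜ \ (Q : Set ℕ)) x y z) a := by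
    intro B hB
    obtain ⟨hB, hc⟩ := Finset.mem_powersetCard.mp hB
    have := sum_nest (B : Set ℕ)ᶜ (p + q + r) q
      (fun Q => ev (p + q + r) (shuffleFun₃ (B : Set ℕ) Q ((B : Set ℕ)ᶜ \ Q) x y z) a)
    have hrank := rank_add_rank_compl (B : Set ℕ) (p + q + r)
    rw [rank_coe_finset hB, hc] at hrank
    rw [show rank (B : Set ℕ)ᶜ (p + q + r) = q + r by omega] at this
    rw [this]
    refine Finset.sum_congr (congrArg _ ?_) fun _ _ => rfl
    ext i
    simp
  rw [Finset.sum_congr rfl hl, Finset.sum_congr rfl hr,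
    sum_powersetCard_powersetCard (f := fun P B => ev (p + q + r) (shuffleFun₃ (P : Set ℕ)
      ((B : Set ℕ) \ (P : Set ℕ)) (B : Set ℕ)ᶜ x y z) a)]
  refine Finset.sum_congr rfl fun P _ => Finset.sum_congr rfl fun Q hQ => ?_
  have hd : Disjoint P Q := Finset.disjoint_of_subset_right (Finset.mem_powersetCard.mp hQ).1
    Finset.disjoint_sdiff
  rw [← Finset.coe_sdiff, Finset.union_sdiff_cancel_left hd, Finset.coe_union, Set.compl_union,
    Set.sdiff_eq]

variable [Fintype F]

theorem comul_one : CoalgebraStruct.comul (R := ℂ) (1 : ScfUT F) = 1 := by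
  refine separating_ev.tmul separating_ev _ _ fun ⟨⟨p, x⟩, ⟨q, y⟩⟩ => ?_
  change tmulFunctional (ev p x) (ev q y) _ = tmulFunctional (ev p x) (ev q y) _
  rw [tmulFunctional_comul, Algebra.TensorProduct.one_def, tmulFunctional_tmul]
  simp only [ev_one]
  rw [Finset.sum_const, Finset.card_powersetCard, Finset.card_range]
  rcases p with _ | p <;> rcases q with _ | q <;> simp [← add_assoc]

theorem counit_one : CoalgebraStruct.counit (R := ℂ) (1 : ScfUT F) = 1 := by
  rw [counit_eq_ev 0, ev_one, if_pos rfl]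

theorem counit_mul (a b : ScfUT F) : CoalgebraStruct.counit (R := ℂ) (a * b)
    = CoalgebraStruct.counit (R := ℂ) a * CoalgebraStruct.counit (R := ℂ) b := by
  rw [counit_eq_ev 0, ev_mul]
  rw [show Finset.HasAntidiagonal.antidiagonal 0 = {((0 : ℕ), (0 : ℕ))} from rfl,
    Finset.sum_singleton]
  rfl

theorem tmulFunctional_comul_incl (p q : ℕ) (x y : ℕ → ℕ → F) (n : ℕ) (ψ : scf (utCl F n)) :
    tmulFunctional (ev p x) (ev q y) (CoalgebraStruct.comul (R := ℂ) (incl F n ψ))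
      = ∑ A ∈ (Finset.range n).powerset, if A.card = p ∧ n - A.card = q then
          ψ.1 (UT.ofFun n (shuffleFun (A : Set ℕ) x y)) else 0 := by
  rw [tmulFunctional_comul]
  simp only [ev_incl]
  by_cases hn : n = p + q
  · subst hn
    simp only [if_true, ← Finset.sum_filter]
    refine Finset.sum_congr ?_ fun _ _ => rfl
    ext A
    simp only [Finset.mem_powersetCard, Finset.mem_filter, Finset.mem_powerset]
    constructor
    · rintro ⟨h1, h2⟩
      exact ⟨h1, h2, by omega⟩
    · rintro ⟨h1, h2, _⟩
      exact ⟨h1, h2⟩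
  · simp only [hn, if_false, Finset.sum_const_zero]
    refine (Finset.sum_eq_zero fun A hA => if_neg ?_).symm
    have := Finset.card_le_card (Finset.mem_powerset.mp hA)
    rw [Finset.card_range] at this
    omega

/-- A subset of `{0, …, m+n-1}` splits into a subset `B` of the first `m` and a subset `C` of the last
`n` indices, and the diagonal blocks of a shuffle along it are shuffles along `B` and `C`. -/
theorem comul_mul (a b : ScfUT F) : CoalgebraStruct.comul (R := ℂ) (a * b)
    = CoalgebraStruct.comul (R := ℂ) a * CoalgebraStruct.comul (R := ℂ) b := by
  induction a using ScfUT.induction with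
  | h0 => simp
  | h2 a a' h h' => simp only [add_mul, map_add, h, h']
  | h1 m ψ =>
  induction b using ScfUT.induction with
  | h0 => simp
  | h2 a a' h h' => simp only [mul_add, map_add, h, h']
  | h1 n γ =>
  refine separating_ev.tmul separating_ev _ _ fun ⟨⟨p, x⟩, ⟨q, y⟩⟩ => ?_
  change tmulFunctional (ev p x) (ev q y) _ = tmulFunctional (ev p x) (ev q y) _
  rw [tmulFunctional_ev_mul]
  have hl : tmulFunctional (ev p x) (ev q y)
      (CoalgebraStruct.comul (R := ℂ) (incl F m ψ * incl F n γ))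
      = ∑ A ∈ (Finset.range (m + n)).powerset, if A.card = p ∧ m + n - A.card = q then
          ψ.1 (UT.ofFun m (shuffleFun (A : Set ℕ) x y))
            * γ.1 (UT.ofFun n (shift m (shuffleFun (A : Set ℕ) x y))) else 0 := by
    refine (congrArg (fun z => tmulFunctional (ev p x) (ev q y) (CoalgebraStruct.comul (R := ℂ) z))
      (incl_mul_incl m n ψ γ)).trans ?_
    refine (tmulFunctional_comul_incl p q x y (m + n) _).trans ?_
    refine Finset.sum_congr rfl fun A _ => ?_
    congr 1
    exact congrArg₂ (· * ·) (congrArg ψ.1 (UT.block_castAdd_ofFun m n _))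
      (congrArg γ.1 (UT.block_natAdd_ofFun m n _))
  rw [hl, sum_powerset_range_add]
  simp only [tmulFunctional_comul_incl, Finset.sum_mul_sum]
  -- move the sums over the subsets to the outside
  have hswap : ∀ G : ℕ × ℕ → ℕ × ℕ → Finset ℕ → Finset ℕ → ℂ,
      ∑ k ∈ Finset.HasAntidiagonal.antidiagonal p, ∑ l ∈ Finset.HasAntidiagonal.antidiagonal q,
        ∑ B ∈ (Finset.range m).powerset, ∑ C ∈ (Finset.range n).powerset, G k l B C
      = ∑ B ∈ (Finset.range m).powerset, ∑ C ∈ (Finset.range n).powerset,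
        ∑ k ∈ Finset.HasAntidiagonal.antidiagonal p, ∑ l ∈ Finset.HasAntidiagonal.antidiagonal q,
        G k l B C := by
    intro G
    exact (Finset.sum_congr rfl fun k _ => Finset.sum_comm).trans (Finset.sum_comm.trans
      (Finset.sum_congr rfl fun B _ => (Finset.sum_congr rfl fun k _ => Finset.sum_comm).trans
        Finset.sum_comm))
  rw [hswap]
  refine Finset.sum_congr rfl fun B hB => Finset.sum_congr rfl fun C hC => ?_
  rw [Finset.mem_powerset] at hB hC
  have h1 : UT.ofFun m (shuffleFun ((B ∪ C.map (addLeftEmbedding m) : Finset ℕ) : Set ℕ) x y)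
      = UT.ofFun m (shuffleFun (B : Set ℕ) x y) :=
    UT.ofFun_congr fun i j hij hj => shuffleFun_union_of_lt x y (hij.trans hj) hj
  rw [h1, shift_shuffleFun_union hB]
  have hcard : (B ∪ C.map (addLeftEmbedding m)).card = B.card + C.card := by
    rw [Finset.card_union_of_disjoint, Finset.card_map]
    rw [Finset.disjoint_left]
    intro i hi hi'
    obtain ⟨c, _, rfl⟩ := Finset.mem_map.mp hi'
    have := Finset.mem_range.mp (hB hi)
    simp at this
  have hBm := Finset.card_le_card hB
  have hCn := Finset.card_le_card hC
  rw [Finset.card_range] at hBm hCn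
  have hcond : (B ∪ C.map (addLeftEmbedding m)).card = p ∧
      m + n - (B ∪ C.map (addLeftEmbedding m)).card = q ↔
      B.card + C.card = p ∧ (m - B.card) + (n - C.card) = q := by
    rw [hcard]
    omega
  simp only [hcond]
  rw [← sum_antidiagonal_ite (p := p) (q := q) (a₁ := B.card) (a₂ := C.card) (b₁ := m - B.card)
    (b₂ := n - C.card) (fun k l => ψ.1 (UT.ofFun m (shuffleFun (B : Set ℕ) x y))
      * γ.1 (UT.ofFun n (shuffleFun (C : Set ℕ) (shift k x) (shift l y))))]
  refine Finset.sum_congr rfl fun k _ => Finset.sum_congr rfl fun l _ => ?_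
  exact ite_and_mul _ _

theorem ev_comul_comp (p q : ℕ) (x y : ℕ → ℕ → F) :
    tmulFunctional (ev p x) (ev q y) ∘ₗ (CoalgebraStruct.comul (R := ℂ) (A := ScfUT F))
      = ∑ A ∈ (Finset.range (p + q)).powersetCard p, ev (p + q) (shuffleFun (A : Set ℕ) x y) := by
  ext a
  rw [LinearMap.comp_apply, tmulFunctional_comul, LinearMap.sum_apply]

theorem coassoc :
    (TensorProduct.assoc ℂ (ScfUT F) (ScfUT F) (ScfUT F)).toLinearMap ∘ₗ
      (CoalgebraStruct.comul (R := ℂ) (A := ScfUT F)).rTensor (ScfUT F) ∘ₗ CoalgebraStruct.comul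
    = (CoalgebraStruct.comul (R := ℂ) (A := ScfUT F)).lTensor (ScfUT F) ∘ₗ
      CoalgebraStruct.comul := by
  refine LinearMap.ext fun a => ?_
  refine separating_ev.tmul (separating_ev.tmul separating_ev) _ _
    fun ⟨⟨p, x⟩, ⟨q, y⟩, ⟨r, z⟩⟩ => ?_
  change tmulFunctional (ev p x) (tmulFunctional (ev q y) (ev r z)) (TensorProduct.assoc ℂ _ _ _
      ((CoalgebraStruct.comul (R := ℂ) (A := ScfUT F)).rTensor (ScfUT F)
        (CoalgebraStruct.comul (R := ℂ) a)))
    = tmulFunctional (ev p x) (tmulFunctional (ev q y) (ev r z))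
      ((CoalgebraStruct.comul (R := ℂ) (A := ScfUT F)).lTensor (ScfUT F)
        (CoalgebraStruct.comul (R := ℂ) a))
  rw [tmulFunctional_assoc, tmulFunctional_map_left, tmulFunctional_map_right, ev_comul_comp,
    ev_comul_comp, tmulFunctional_sum_left, tmulFunctional_sum_right]
  simp only [tmulFunctional_comul]
  exact sum_ev_shuffleFun p q r x y z a

theorem separating_id : Separating (fun _ : Unit => (LinearMap.id : ℂ →ₗ[ℂ] ℂ)) :=
  fun _ _ h => h ()

theorem rTensor_counit_comp_comul :
    (CoalgebraStruct.counit (R := ℂ) (A := ScfUT F)).rTensor (ScfUT F) ∘ₗ CoalgebraStruct.comul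
      = TensorProduct.mk ℂ ℂ (ScfUT F) 1 := by
  refine LinearMap.ext fun a => ?_
  refine separating_id.tmul separating_ev _ _ fun ⟨_, q, y⟩ => ?_
  change tmulFunctional LinearMap.id (ev q y) ((CoalgebraStruct.counit (R := ℂ)).rTensor (ScfUT F)
    (CoalgebraStruct.comul (R := ℂ) a)) = tmulFunctional LinearMap.id (ev q y) (1 ⊗ₜ a)
  rw [tmulFunctional_map_left, LinearMap.id_comp, counit_eq_ev 0, tmulFunctional_comul,
    Finset.powersetCard_zero, Finset.sum_singleton, tmulFunctional_tmul, LinearMap.id_apply,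
    one_mul, zero_add, Finset.coe_empty, shuffleFun_empty]

theorem lTensor_counit_comp_comul :
    (CoalgebraStruct.counit (R := ℂ) (A := ScfUT F)).lTensor (ScfUT F) ∘ₗ CoalgebraStruct.comul
      = (TensorProduct.mk ℂ (ScfUT F) ℂ).flip 1 := by
  refine LinearMap.ext fun a => ?_
  refine separating_ev.tmul separating_id _ _ fun ⟨⟨p, x⟩, _⟩ => ?_
  change tmulFunctional (ev p x) LinearMap.id ((CoalgebraStruct.counit (R := ℂ)).lTensor (ScfUT F)
    (CoalgebraStruct.comul (R := ℂ) a)) = tmulFunctional (ev p x) LinearMap.id (a ⊗ₜ 1)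
  have hself : (Finset.range p).powersetCard p = {Finset.range p} := by
    conv_lhs => rw [← Finset.card_range p, Finset.card_range p]
    simpa using Finset.powersetCard_self (Finset.range p)
  rw [tmulFunctional_map_right, LinearMap.id_comp, counit_eq_ev 0, tmulFunctional_comul,
    tmulFunctional_tmul, LinearMap.id_apply, mul_one, add_zero, hself, Finset.sum_singleton]
  exact ev_congr (fun i j hij hj => shuffleFun_range x 0 (hij.trans hj) hj) a

theorem isCoalgebra : ∃ c : Coalgebra ℂ (ScfUT F),
    c.toCoalgebraStruct = (inferInstance : CoalgebraStruct ℂ (ScfUT F)) :=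
  ⟨{ coassoc := coassoc
     rTensor_counit_comp_comul := rTensor_counit_comp_comul
     lTensor_counit_comp_comul := lTensor_counit_comp_comul }, rfl⟩

theorem isHopf : IsHopf (ScfUT F) where
  isCoalgebra := isCoalgebra
  counit_one := counit_one
  counit_mul := counit_mul
  comul_one := comul_one
  comul_mul := comul_mul
  antipode := by
    refine exists_antipode (M := fun n => scf (utCl F n)) isCoalgebra (incl F)
      (LinearEquiv.refl ℂ (⨁ n, UPiece F n)) (fun _ _ => rfl) counit_one ?_ ?_
    · intro ψ
      refine ⟨ψ.1 1, ?_⟩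
      rw [one_eq_incl, ← map_smul]
      congr 1
      refine Subtype.ext (funext fun u => ?_)
      rw [Subsingleton.elim u 1]
      exact (mul_one (ψ.1 1)).symm
    · intro n ψ
      rw [comul_incl]
      refine Submodule.sum_mem _ fun A _ => ?_
      induction scf.toTensor _ _ (resUT A ψ) with
      | zero => simp
      | add s t hs ht => rw [map_add]; exact Submodule.add_mem _ hs ht
      | tmul φ γ =>
        refine Submodule.subset_span ⟨A.card, Aᶜ.card, φ, γ, ?_, rfl⟩
        rw [A.card_add_card_compl, Fintype.card_fin]

end ScfUT

/-! ### Sub-bialgebras -/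

section Transfer

theorem tensorMap_injective {M M' N N' : Type*} [AddCommMonoid M] [AddCommMonoid M']
    [AddCommMonoid N] [AddCommMonoid N'] [Module ℂ M] [Module ℂ M'] [Module ℂ N] [Module ℂ N']
    {f : M →ₗ[ℂ] N} {g : M' →ₗ[ℂ] N'} (hf : Function.Injective f) (hg : Function.Injective g) :
    Function.Injective (TensorProduct.map f g) := by
  let : AddCommGroup M' := Module.addCommMonoidToAddCommGroup ℂ
  let : AddCommGroup N := Module.addCommMonoidToAddCommGroup ℂ
  exact TensorProduct.map_injective_of_flat_flat f g hf hg

variable {A B : Type*} [AddCommMonoid A] [Module ℂ A] [co : CoalgebraStruct ℂ A]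
  [AddCommMonoid B] [Module ℂ B] [co' : CoalgebraStruct ℂ B]

/-- The coalgebra axioms descend along an injective map that respects the operations, because its
tensor powers over a field are injective as well. -/
theorem isCoalgebra_of_injective (hB : ∃ c : Coalgebra ℂ B, c.toCoalgebraStruct = co')
    (Φ : A →ₗ[ℂ] B) (hΦ : Function.Injective Φ)
    (hε : CoalgebraStruct.counit ∘ₗ Φ = CoalgebraStruct.counit)
    (hΔ : TensorProduct.map Φ Φ ∘ₗ CoalgebraStruct.comul = CoalgebraStruct.comul ∘ₗ Φ) :
    ∃ c : Coalgebra ℂ A, c.toCoalgebraStruct = co := by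
  obtain ⟨c, rfl⟩ := hB
  have hΔ' : ∀ a, TensorProduct.map Φ Φ (CoalgebraStruct.comul a) = CoalgebraStruct.comul (Φ a) :=
    LinearMap.congr_fun hΔ
  refine ⟨{ coassoc := ?_, rTensor_counit_comp_comul := ?_, lTensor_counit_comp_comul := ?_ }, rfl⟩
  · refine LinearMap.ext fun a => tensorMap_injective hΦ (tensorMap_injective hΦ hΦ) ?_
    simp only [LinearMap.comp_apply, LinearEquiv.coe_coe]
    rw [TensorProduct.map_map_assoc]
    have h1 : ∀ t : A ⊗[ℂ] A, TensorProduct.map (TensorProduct.map Φ Φ) Φ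
        (CoalgebraStruct.comul.rTensor A t)
        = CoalgebraStruct.comul.rTensor B (TensorProduct.map Φ Φ t) := by
      intro t
      rw [← LinearMap.comp_apply, ← LinearMap.comp_apply, LinearMap.rTensor_comp_map,
        LinearMap.map_comp_rTensor, hΔ]
    have h2 : ∀ t : A ⊗[ℂ] A, TensorProduct.map Φ (TensorProduct.map Φ Φ)
        (CoalgebraStruct.comul.lTensor A t)
        = CoalgebraStruct.comul.lTensor B (TensorProduct.map Φ Φ t) := by
      intro t
      rw [← LinearMap.comp_apply, ← LinearMap.comp_apply, LinearMap.lTensor_comp_map,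
        LinearMap.map_comp_lTensor, hΔ]
    rw [h1, h2, hΔ', Coalgebra.coassoc_apply]
  · refine LinearMap.ext fun a => tensorMap_injective (f := LinearMap.id) (g := Φ)
      (fun _ _ h => h) hΦ ?_
    have h1 : ∀ t : A ⊗[ℂ] A, TensorProduct.map LinearMap.id Φ
        (CoalgebraStruct.counit.rTensor A t)
        = CoalgebraStruct.counit.rTensor B (TensorProduct.map Φ Φ t) := by
      intro t
      rw [← LinearMap.comp_apply, ← LinearMap.comp_apply, LinearMap.rTensor_comp_map,
        LinearMap.map_comp_rTensor, hε, LinearMap.id_comp]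
    rw [LinearMap.comp_apply, h1, hΔ', Coalgebra.rTensor_counit_comul]
    rfl
  · refine LinearMap.ext fun a => tensorMap_injective (f := Φ) (g := LinearMap.id)
      hΦ (fun _ _ h => h) ?_
    have h1 : ∀ t : A ⊗[ℂ] A, TensorProduct.map Φ LinearMap.id
        (CoalgebraStruct.counit.lTensor A t)
        = CoalgebraStruct.counit.lTensor B (TensorProduct.map Φ Φ t) := by
      intro t
      rw [← LinearMap.comp_apply, ← LinearMap.comp_apply, LinearMap.lTensor_comp_map,
        LinearMap.map_comp_lTensor, hε, LinearMap.id_comp]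
    rw [LinearMap.comp_apply, h1, hΔ', Coalgebra.lTensor_counit_comul]
    rfl

end Transfer

/-! ### The coproduct for the parameters `(1, reg, reg)` -/

section Down

variable {G : Type*} [Group G] [Fintype G]

open Classical in
/-- Multiplication by `reg` followed by deflation is evaluation at the identity. -/
theorem down_one_reg_reg {n : ℕ} (A : Finset (Fin n)) (ψ : scf (powSetoid (trivialCl G) (n - 1)))
    (p : (Fin (A.card - 1) → G) × (Fin (Aᶜ.card - 1) → G)) :
    (down (scf.one (trivialCl G)) (reg G) (reg G) A ψ).1 p
      = ψ.1 (fun j => if Bc A j then shuffle A p j else 1) := by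
  have h1 : tauFactor (scf.one (trivialCl G)) A (shuffle A p) = 1 :=
    Finset.prod_eq_one fun j _ => by split_ifs <;> rfl
  change tauFactor (scf.one (trivialCl G)) A (shuffle A p) * defl (Bc A) _ (shuffle A p) = _
  rw [h1, one_mul, defl]
  set h := shuffle A p
  have h2 : ∀ x : Fin (n - 1) → G,
      alphaBeta (reg G) (reg G) A (fun j => if Bc A j then h j else x j)
        * ψ.1 (fun j => if Bc A j then h j else x j)
      = (∏ j, if Bc A j then 1 else (reg G).1 (x j))
        * ψ.1 (fun j => if Bc A j then h j else 1) := by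
    intro x
    have h3 : alphaBeta (reg G) (reg G) A (fun j => if Bc A j then h j else x j)
        = ∏ j, if Bc A j then 1 else (reg G).1 (x j) := by
      refine Finset.prod_congr rfl fun j _ => ?_
      by_cases hj : Bc A j <;> simp [hj]
    rw [h3]
    by_cases hx : ∀ j, ¬ Bc A j → x j = 1
    · congr 1
      refine congrArg ψ.1 (funext fun j => ?_)
      by_cases hj : Bc A j
      · simp [hj]
      · simp [hj, hx j hj]
    · push Not at hx
      obtain ⟨j, hj, hxj⟩ := hx
      rw [Finset.prod_eq_zero (Finset.mem_univ j), zero_mul, zero_mul]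
      rw [if_neg hj]
      exact if_neg hxj
  have h4 : ∑ x : Fin (n - 1) → G, ∏ j, (if Bc A j then 1 else (reg G).1 (x j))
      = (Fintype.card (Fin (n - 1) → G) : ℂ) := by
    have := Finset.prod_univ_sum (fun _ : Fin (n - 1) => (Finset.univ : Finset G))
      (fun j g => if Bc A j then 1 else (reg G).1 g)
    rw [Fintype.piFinset_univ] at this
    rw [← this]
    have h5 : ∀ j, ∑ g : G, (if Bc A j then 1 else (reg G).1 g) = (Fintype.card G : ℂ) := by
      intro j
      by_cases hj : Bc A j
      · simp [hj]
      · simp [hj, reg]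
    simp [h5]
  simp only [h2]
  rw [← Finset.sum_mul, h4, inv_mul_cancel_left₀]
  exact Nat.cast_ne_zero.mpr Fintype.card_ne_zero

end Down

/-! ### Inflation as a morphism -/

section Inflation

variable {F : Type*} [Field F]

open Classical in
/-- Neighbours `j`, `j+1` in the same block of `UT_{|A|} × UT_{|Aᶜ|}` keep the entry of that block on the
superdiagonal; between different blocks the entry is `0`. -/
theorem superdiag_shuffleUT {n : ℕ} (A : Finset (Fin n)) (u : UT F A.card) (v : UT F Aᶜ.card) :
    superdiag F n (shuffleUT A (u, v)) = fun j => if Bc A j then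
      shuffle A (superdiag F A.card u, superdiag F Aᶜ.card v) j else 1 := by
  -- neighbours in the same block are neighbours in the numbering of the block
  have hnext : ∀ (k : ℕ) (f : Fin k ↪o Fin n) (j : Fin (n - 1)) (a b : Fin k), f a = lo j →
      f b = hi j → b.val = a.val + 1 := by
    intro k f j a b ha hb
    have hab : a < b := by
      rw [← f.lt_iff_lt, ha, hb]
      exact Nat.lt_succ_self j.val
    by_contra hne
    have hlt : a.val + 1 < b.val := by
      have : a.val < b.val := hab
      omega
    have h1 : f a < f ⟨a.val + 1, hlt.trans b.2⟩ := f.lt_iff_lt.mpr (Nat.lt_succ_self a.val)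
    have h2 : f ⟨a.val + 1, hlt.trans b.2⟩ < f b := f.lt_iff_lt.mpr hlt
    rw [ha] at h1
    rw [hb] at h2
    have h1' : j.val < (f ⟨a.val + 1, hlt.trans b.2⟩).val := h1
    have h2' : (f ⟨a.val + 1, hlt.trans b.2⟩).val < j.val + 1 := h2
    omega
  have hcoord : ∀ (k : ℕ) (w : UT F k) (a b : Fin k), b.val = a.val + 1 →
      Multiplicative.ofAdd (w.1 a b) = coord (superdiag F k w) a := by
    intro k w a b hab
    have ha : a.val < k - 1 := by
      have := b.2
      omega
    rw [coord, dif_pos ha]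
    have hb : b = hi (⟨a.val, ha⟩ : Fin (k - 1)) := Fin.ext hab
    rw [hb]
    rfl
  have hl : ∀ k : Fin A.card, finSumEquivOfFinset (s := A) rfl rfl (Sum.inl k) ∈ A :=
    fun k => by rw [finSumEquivOfFinset_inl]; exact A.orderEmbOfFin_mem rfl k
  have hr : ∀ k : Fin Aᶜ.card, finSumEquivOfFinset (s := A) rfl rfl (Sum.inr k) ∉ A :=
    fun k => Finset.mem_compl.mp
      (by rw [finSumEquivOfFinset_inr]; exact Aᶜ.orderEmbOfFin_mem rfl k)
  funext j
  change Multiplicative.ofAdd (Matrix.fromBlocks u.1 0 0 v.1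
    ((finSumEquivOfFinset (s := A) rfl rfl).symm (lo j))
    ((finSumEquivOfFinset (s := A) rfl rfl).symm (hi j))) = _
  rw [Bc, shuffle]
  obtain ⟨a, ha⟩ := (finSumEquivOfFinset (s := A) rfl rfl).surjective (lo j)
  obtain ⟨b, hb⟩ := (finSumEquivOfFinset (s := A) rfl rfl).surjective (hi j)
  rw [← ha, ← hb, Equiv.symm_apply_apply, Equiv.symm_apply_apply]
  rcases a with a | a <;> rcases b with b | b
  · rw [if_pos (iff_of_true (hl a) (hl b))]
    rw [finSumEquivOfFinset_inl] at ha hb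
    exact hcoord _ u a b (hnext _ _ j a b ha hb)
  · rw [if_neg (fun h => hr b (h.mp (hl a)))]
    rfl
  · rw [if_neg (fun h => hr a (h.mpr (hl b)))]
    rfl
  · rw [if_pos (iff_of_false (hr a) (hr b))]
    rw [finSumEquivOfFinset_inr] at ha hb
    exact hcoord _ v a b (hnext _ _ j a b ha hb)

theorem superdiag_surjective (n : ℕ) : Function.Surjective (superdiag F n) := by
  intro g
  refine ⟨UT.ofFun n (fun i _ => if h : i < n - 1 then (g ⟨i, h⟩).toAdd else 0), ?_⟩
  funext i
  have hlt : (lo i : Fin n) < hi i := Nat.lt_succ_self i.val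
  change Multiplicative.ofAdd ((UT.ofFun n _).1 (lo i) (hi i)) = _
  rw [UT.ofFun_apply, if_pos hlt]
  simp [lo]

theorem infl_injective (n : ℕ) : Function.Injective (infl F n) := by
  intro ψ γ h
  refine Subtype.ext (funext fun g => ?_)
  obtain ⟨u, rfl⟩ := superdiag_surjective n g
  exact congrFun (congrArg Subtype.val h) u

theorem infl_one (n : ℕ) : infl F n (scf.one _) = scf.one _ := rfl

theorem infl_mulPiece {m n : ℕ} (ψ : Piece (scf.one (trivialCl (Multiplicative F))) m)
    (γ : Piece (scf.one (trivialCl (Multiplicative F))) n) :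
    infl F (m + n) (mulPiece _ ψ γ) = mulUPiece (infl F m ψ) (infl F n γ) := by
  refine Subtype.ext (funext fun u => ?_)
  change ψ.1 _ * (∏ k : Fin (m + n - 1), if k.val + 1 = m then (1 : ℂ) else 1) * γ.1 _
    = ψ.1 _ * γ.1 _
  simp only [ite_self, Finset.prod_const_one, mul_one]
  rfl

theorem scf.separating_proj {X : Type*} (r : Setoid X) :
    Separating (fun x : X => LinearMap.proj x ∘ₗ (scf r).subtype) :=
  fun _ _ h => Subtype.ext (funext h)

theorem scf.separating_evalTensor {X Y : Type*} (r : Setoid X) (s : Setoid Y) :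
    Separating (fun p : X × Y => scf.evalTensor r s p.1 p.2) := by
  intro t t' h
  refine (scf.separating_proj r).tmul (scf.separating_proj s) t t' fun p => ?_
  exact h p

variable [Fintype F]

/-- Inflation turns the coproduct components of `ℋ` into restrictions: both evaluate at the superdiagonal
of a block matrix. -/
theorem map_infl_toTensor_down {n : ℕ} (A : Finset (Fin n))
    (ψ : scf (powSetoid (trivialCl (Multiplicative F)) (n - 1))) :
    TensorProduct.map (infl F A.card) (infl F Aᶜ.card) (scf.toTensor _ _
        (down (scf.one _) (reg (Multiplicative F)) (reg (Multiplicative F)) A ψ))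
      = scf.toTensor _ _ (resUT A (infl F n ψ)) := by
  classical
  refine scf.separating_evalTensor _ _ _ _ fun ⟨u, v⟩ => ?_
  dsimp only
  have hev : scf.evalTensor _ _ u v ∘ₗ TensorProduct.map (infl F A.card) (infl F Aᶜ.card)
      = scf.evalTensor _ _ (superdiag F A.card u) (superdiag F Aᶜ.card v) := by
    ext
    rfl
  rw [← LinearMap.comp_apply, hev, scf.evalTensor_toTensor, scf.evalTensor_toTensor,
    down_one_reg_reg]
  change _ = ψ.1 (superdiag F n (shuffleUT A (u, v)))
  rw [superdiag_shuffleUT]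

namespace HOne

variable (F)

/-- The inclusion of the degree `n` component of `ℋ_(1,reg,reg)`. -/
abbrev incl (n : ℕ) : scf (powSetoid (trivialCl (Multiplicative F)) (n - 1)) →ₗ[ℂ] HOne F :=
  TowerAlg.incl _ _ _ n

/-- Inflation in all degrees, as a linear map. -/
def inflation : HOne F →ₗ[ℂ] ScfUT F :=
  TowerAlg.lift _ _ _ fun n => ScfUT.incl F n ∘ₗ infl F n

variable {F}

theorem inflation_incl (n : ℕ) (ψ : scf (powSetoid (trivialCl (Multiplicative F)) (n - 1))) :
    inflation F (incl F n ψ) = ScfUT.incl F n (infl F n ψ) :=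
  TowerAlg.lift_incl _ _ _ _ n ψ

theorem induction {P : HOne F → Prop} (h0 : P 0) (h1 : ∀ n ψ, P (incl F n ψ))
    (h2 : ∀ a b, P a → P b → P (a + b)) (a : HOne F) : P a :=
  DirectSum.induction_on (β := Piece (scf.one (trivialCl (Multiplicative F)))) a h0 h1 h2

theorem linearMap_ext {M : Type*} [AddCommMonoid M] [Module ℂ M] {f g : HOne F →ₗ[ℂ] M}
    (h : ∀ n ψ, f (incl F n ψ) = g (incl F n ψ)) : f = g :=
  DirectSum.linearMap_ext (M := Piece (scf.one (trivialCl (Multiplicative F)))) ℂ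
    fun n => LinearMap.ext fun ψ => h n ψ

theorem inflation_injective : Function.Injective (inflation F) := by
  have hinj : Function.Injective (DirectSum.lmap (R := ℂ)
      (fun n => (infl F n : Piece (scf.one (trivialCl (Multiplicative F))) n →ₗ[ℂ] UPiece F n))) :=
    DFinsupp.mapRange_injective (fun n => infl F n) (fun n => map_zero (infl F n)) |>.mpr
      infl_injective
  have heq : inflation F = (DirectSum.lmap (R := ℂ)
      (fun n => (infl F n : Piece (scf.one (trivialCl (Multiplicative F))) n →ₗ[ℂ] UPiece F n)) :
        HOne F →ₗ[ℂ] ScfUT F) := by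
    refine linearMap_ext fun n ψ => ?_
    rw [inflation_incl]
    exact (DirectSum.lmap_lof (R := ℂ) (f := fun n =>
      (infl F n : Piece (scf.one (trivialCl (Multiplicative F))) n →ₗ[ℂ] UPiece F n)) n ψ).symm
  rw [heq]
  exact hinj

theorem one_eq_incl : (1 : HOne F) = incl F 0 (scf.one _) := by
  refine (DirectSum.one_def (Piece (scf.one (trivialCl (Multiplicative F))))).trans ?_
  exact congrArg (incl F 0) (one_smul ℂ (scf.one (powSetoid (trivialCl (Multiplicative F)) (0 - 1))))

theorem inflation_one : inflation F 1 = 1 := by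
  rw [one_eq_incl, inflation_incl, ScfUT.one_eq_incl, infl_one]

theorem inflation_mul (a b : HOne F) :
    inflation F (a * b) = inflation F a * inflation F b := by
  induction a using HOne.induction with
  | h0 => simp
  | h2 a a' h h' => simp only [add_mul, map_add, h, h']
  | h1 m ψ =>
    induction b using HOne.induction with
    | h0 => simp
    | h2 b b' h h' => simp only [mul_add, map_add, h, h']
    | h1 n γ =>
      have h1 : incl F m ψ * incl F n γ = incl F (m + n)
          (mulPiece (scf.one (trivialCl (Multiplicative F))) (m := m) (n := n) ψ γ) :=
        DirectSum.of_mul_of (A := Piece (scf.one (trivialCl (Multiplicative F)))) ψ γ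
      rw [inflation_incl, inflation_incl]
      refine (congrArg (inflation F) h1).trans ((inflation_incl _ _).trans ?_)
      refine (congrArg (ScfUT.incl F (m + n)) (infl_mulPiece ψ γ)).trans ?_
      exact (ScfUT.incl_mul_incl m n _ _).symm

theorem comul_incl (n : ℕ) (ψ : scf (powSetoid (trivialCl (Multiplicative F)) (n - 1))) :
    CoalgebraStruct.comul (R := ℂ) (incl F n ψ) = ∑ A : Finset (Fin n),
      TensorProduct.map (incl F A.card) (incl F Aᶜ.card) (scf.toTensor _ _
        (down (scf.one _) (reg (Multiplicative F)) (reg (Multiplicative F)) A ψ)) := by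
  refine (TowerAlg.lift_incl _ _ _ _ n ψ).trans ?_
  simp

theorem counit_incl (n : ℕ) (ψ : scf (powSetoid (trivialCl (Multiplicative F)) (n - 1))) :
    CoalgebraStruct.counit (R := ℂ) (incl F n ψ) = if n = 0 then ψ.1 (fun _ => 1) else 0 := by
  refine (TowerAlg.lift_incl _ _ _ _ n ψ).trans ?_
  split_ifs <;> rfl

theorem counit_comp_inflation : CoalgebraStruct.counit ∘ₗ inflation F
    = (CoalgebraStruct.counit : HOne F →ₗ[ℂ] ℂ) := by
  refine linearMap_ext fun n ψ => ?_
  rw [LinearMap.comp_apply, inflation_incl, ScfUT.counit_incl, counit_incl]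
  congr 1
  exact congrArg ψ.1 (map_one (superdiag F n))

theorem map_comp_comul_inflation :
    TensorProduct.map (inflation F) (inflation F) ∘ₗ CoalgebraStruct.comul
      = CoalgebraStruct.comul ∘ₗ inflation F := by
  refine linearMap_ext fun n ψ => ?_
  rw [LinearMap.comp_apply, LinearMap.comp_apply, comul_incl, inflation_incl, ScfUT.comul_incl,
    map_sum]
  refine Finset.sum_congr rfl fun A _ => ?_
  rw [← map_infl_toTensor_down]
  have h : TensorProduct.map (inflation F) (inflation F) ∘ₗ
      TensorProduct.map (incl F A.card) (incl F Aᶜ.card)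
      = TensorProduct.map (ScfUT.incl F A.card) (ScfUT.incl F Aᶜ.card) ∘ₗ
        TensorProduct.map (infl F A.card) (infl F Aᶜ.card) := by
    rw [← TensorProduct.map_comp, ← TensorProduct.map_comp]
    congr 1 <;> exact LinearMap.ext fun φ => inflation_incl _ φ
  exact LinearMap.congr_fun h _

theorem isCoalgebra : ∃ c : Coalgebra ℂ (HOne F),
    c.toCoalgebraStruct = (inferInstance : CoalgebraStruct ℂ (HOne F)) :=
  isCoalgebra_of_injective ScfUT.isCoalgebra (inflation F) inflation_injective
    counit_comp_inflation map_comp_comul_inflation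

variable (F) in
/-- Inflation as a morphism of bialgebras. -/
def inflationHom : HOne F →ₐc[ℂ] ScfUT F where
  toLinearMap := inflation F
  counit_comp := counit_comp_inflation
  map_comp_comul := map_comp_comul_inflation
  map_one' := inflation_one
  map_mul' := inflation_mul

theorem counit_inflation (a : HOne F) : CoalgebraStruct.counit (R := ℂ) (inflation F a)
    = CoalgebraStruct.counit (R := ℂ) a := LinearMap.congr_fun counit_comp_inflation a

theorem comul_inflation (a : HOne F) : TensorProduct.map (inflation F) (inflation F)
    (CoalgebraStruct.comul (R := ℂ) a) = CoalgebraStruct.comul (R := ℂ) (inflation F a) :=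
  LinearMap.congr_fun map_comp_comul_inflation a

theorem map_inflation_mul (s t : HOne F ⊗[ℂ] HOne F) :
    TensorProduct.map (inflation F) (inflation F) (s * t)
      = TensorProduct.map (inflation F) (inflation F) s
        * TensorProduct.map (inflation F) (inflation F) t := by
  induction s with
  | zero => simp
  | add s s' h h' => simp only [add_mul, map_add, h, h']
  | tmul a b =>
    induction t with
    | zero => simp
    | add s s' h h' => simp only [mul_add, map_add, h, h']
    | tmul c d =>
      simp only [Algebra.TensorProduct.tmul_mul_tmul, TensorProduct.map_tmul, inflation_mul]

theorem counit_one : CoalgebraStruct.counit (R := ℂ) (1 : HOne F) = 1 := by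
  rw [← counit_inflation, inflation_one, ScfUT.counit_one]

theorem isHopf : IsHopf (HOne F) where
  isCoalgebra := isCoalgebra
  counit_one := counit_one
  counit_mul a b := by
    simp only [← counit_inflation, inflation_mul, ScfUT.counit_mul]
  comul_one := by
    refine tensorMap_injective inflation_injective inflation_injective ?_
    rw [comul_inflation, inflation_one, ScfUT.comul_one, Algebra.TensorProduct.one_def,
      Algebra.TensorProduct.one_def, TensorProduct.map_tmul, inflation_one]
  comul_mul a b := by
    refine tensorMap_injective inflation_injective inflation_injective ?_
    rw [map_inflation_mul, comul_inflation, comul_inflation, comul_inflation, inflation_mul,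
      ScfUT.comul_mul]
  antipode := by
    refine exists_antipode
      (M := fun n => scf (powSetoid (trivialCl (Multiplicative F)) (n - 1))) isCoalgebra (incl F)
      (LinearEquiv.refl ℂ (⨁ n, Piece (scf.one (trivialCl (Multiplicative F))) n))
      (fun _ _ => rfl) counit_one ?_ ?_
    · intro ψ
      refine ⟨ψ.1 1, ?_⟩
      rw [one_eq_incl, ← map_smul]
      congr 1
      refine Subtype.ext (funext fun u => ?_)
      rw [Subsingleton.elim (α := Fin 0 → Multiplicative F) u 1]
      exact (mul_one (ψ.1 1)).symm
    · intro n ψ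
      rw [comul_incl]
      refine Submodule.sum_mem _ fun A _ => ?_
      induction scf.toTensor _ _
        (down (scf.one _) (reg (Multiplicative F)) (reg (Multiplicative F)) A ψ) with
      | zero => simp
      | add s t hs ht => rw [map_add]; exact Submodule.add_mem _ hs ht
      | tmul φ γ =>
        refine Submodule.subset_span ⟨A.card, Aᶜ.card, φ, γ, ?_, rfl⟩
        rw [A.card_add_card_compl, Fintype.card_fin]

end HOne

end Inflation

/-! ### The abelianization of the unipotent group -/

section Abelianization

variable {F : Type*} [Field F] {n : ℕ}

/-- The elementary unipotent matrix with entry `t` in position `(i, j)`. -/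
def UT.elementary {i j : Fin n} (h : i < j) (t : F) : UT F n :=
  ⟨Matrix.transvection i j t, by
    constructor
    · intro k l hkl
      have hlk : l < k := hkl
      rw [Matrix.transvection, Matrix.add_apply, Matrix.one_apply_ne hlk.ne', zero_add,
        Matrix.single_apply_of_ne]
      rintro ⟨rfl, rfl⟩
      exact absurd h (not_lt_of_gt hlk)
    · intro k
      rw [Matrix.transvection, Matrix.add_apply, Matrix.one_apply_eq, Matrix.single_apply_of_ne,
        add_zero]
      rintro ⟨rfl, rfl⟩
      exact absurd h (lt_irrefl _)⟩

/-- An elementary matrix off the superdiagonal is the commutator of two elementary matrices. -/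
theorem UT.elementary_mem_commutator {i j k : Fin n} (hij : i < j) (hjk : j < k) (t : F) :
    UT.elementary (hij.trans hjk) t ∈ commutator (UT F n) := by
  have key : UT.elementary hij 1 * UT.elementary hjk t
      = UT.elementary (hij.trans hjk) t * (UT.elementary hjk t * UT.elementary hij (1 : F)) := by
    apply Subtype.ext
    change Matrix.transvection i j 1 * Matrix.transvection j k t
      = Matrix.transvection i k t * (Matrix.transvection j k t * Matrix.transvection i j 1)
    have h1 := hij.ne'
    have h2 := hjk.ne'
    have h3 := (hij.trans hjk).ne'
    simp only [Matrix.transvection, add_mul, mul_add, one_mul, mul_one,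
      Matrix.single_mul_single_same, Matrix.single_mul_single_of_ne _ _ _ _ h2,
      Matrix.single_mul_single_of_ne _ _ _ _ h3, add_zero]
    abel
  have : UT.elementary (hij.trans hjk) t = ⁅UT.elementary hij (1 : F), UT.elementary hjk t⁆ := by
    rw [commutatorElement_def, mul_assoc _ _ (UT.elementary hjk t)⁻¹, ← mul_inv_rev,
      eq_mul_inv_iff_mul_eq]
    rw [key]
  rw [this]
  exact Subgroup.commutator_mem_commutator (Subgroup.mem_top _) (Subgroup.mem_top _)

/-- A unipotent matrix with zero superdiagonal is reduced to the identity by row operations, from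
the bottom row upwards, that clear one entry at a time; these are commutators. -/
theorem mem_commutator_of_superdiag_eq_one {u : UT F n} (hu : superdiag F n u = 1) :
    u ∈ commutator (UT F n) := by
  classical
  let supp : UT F n → Finset (Fin n × Fin n) := fun v =>
    Finset.univ.filter fun p => p.1 < p.2 ∧ v.1 p.1 p.2 ≠ 0
  have hsupp : ∀ v p, p ∈ supp v ↔ p.1 < p.2 ∧ v.1 p.1 p.2 ≠ 0 := fun v p => by simp [supp]
  induction hN : (supp u).card using Nat.strong_induction_on generalizing u with
  | _ N ih =>
  rcases (supp u).eq_empty_or_nonempty with h | h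
  · have : u = 1 := by
      refine UT.ext_of_lt fun i j hij => ?_
      have hne : (i, j) ∉ supp u := by rw [h]; simp
      rw [hsupp] at hne
      push Not at hne
      rw [hne hij]
      exact (Matrix.one_apply_ne hij.ne).symm
    rw [this]
    exact one_mem _
  · obtain ⟨⟨r, j⟩, hmem, hmax⟩ := Finset.exists_max_image (supp u) Prod.fst h
    rw [hsupp] at hmem
    obtain ⟨hrj, hne⟩ := hmem
    dsimp only at hrj hne
    have hlt : r.val + 1 < j.val := by
      have h1 : r.val < j.val := hrj
      rcases Nat.lt_or_ge (r.val + 1) j.val with h2 | h2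
      · exact h2
      · exfalso
        have h3 : r.val < n - 1 := by
          have := j.2
          omega
        have h4 := congrFun hu ⟨r.val, h3⟩
        have h5 : (hi ⟨r.val, h3⟩ : Fin n) = j := Fin.ext (by simp only [hi]; omega)
        have h6 : (lo ⟨r.val, h3⟩ : Fin n) = r := rfl
        have h7 : u.1 (lo ⟨r.val, h3⟩) (hi ⟨r.val, h3⟩) = 0 := h4
        rw [h5, h6] at h7
        exact hne h7
    let s : Fin n := ⟨r.val + 1, hlt.trans j.2⟩
    have hrs : r < s := Nat.lt_succ_self r.val
    have hsj : s < j := hlt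
    have hE := UT.elementary_mem_commutator hrs hsj (-(u.1 r j))
    set E : UT F n := UT.elementary (hrs.trans hsj) (-(u.1 r j)) with hEdef
    -- the rows below `r` are those of the identity matrix
    have hrow : ∀ k, u.1 j k = if j = k then 1 else 0 := by
      intro k
      rcases lt_trichotomy j k with hjk | rfl | hjk
      · rw [if_neg hjk.ne]
        by_contra hc
        exact absurd (hmax (j, k) ((hsupp _ _).mpr ⟨hjk, hc⟩)) (not_le_of_gt hrj)
      · rw [if_pos rfl, u.2.2]
      · rw [if_neg hjk.ne', u.2.1 hjk]
    have hval : ∀ i k, (E * u).1 i k = if i = r ∧ k = j then 0 else u.1 i k := by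
      intro i k
      change (Matrix.transvection r j (-(u.1 r j)) * u.1) i k = _
      rw [Matrix.transvection, add_mul, one_mul, Matrix.add_apply]
      by_cases hi : i = r
      · subst hi
        rw [Matrix.single_mul_apply_same, hrow]
        by_cases hk : j = k
        · subst hk
          simp
        · simp [hk, Ne.symm hk]
      · rw [Matrix.single_mul_apply_of_ne _ _ _ _ _ hi, add_zero, if_neg (fun h => hi h.1)]
    have hsd : superdiag F n (E * u) = 1 := by
      funext i
      have := congrFun hu i
      change (E * u).1 (lo i) (hi i) = 0
      rw [hval]
      split_ifs
      · rfl
      · exact this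
    have hcard : (supp (E * u)).card < N := by
      rw [← hN]
      refine Finset.card_lt_card ⟨fun p hp => ?_, fun hsub => ?_⟩
      · rw [hsupp] at hp ⊢
        rw [hval] at hp
        refine ⟨hp.1, fun h0 => hp.2 ?_⟩
        split_ifs
        · rfl
        · exact h0
      · have := hsub ((hsupp u (r, j)).mpr ⟨hrj, hne⟩)
        rw [hsupp, hval] at this
        simp at this
    have := ih _ hcard hsd rfl
    exact (Subgroup.mul_mem_cancel_left _ hE).mp this

theorem abelianization_lift_superdiag_bijective :
    Function.Bijective (Abelianization.lift (superdiag F n)) := by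
  constructor
  · rw [injective_iff_map_eq_one]
    intro a ha
    obtain ⟨u, rfl⟩ := QuotientGroup.mk_surjective a
    exact (QuotientGroup.eq_one_iff u).mpr (mem_commutator_of_superdiag_eq_one ha)
  · intro g
    obtain ⟨u, rfl⟩ := superdiag_surjective n g
    exact ⟨Abelianization.of u, Abelianization.lift_apply_of _ u⟩

end Abelianization

/-! ### Characters of the superdiagonal -/

section Supercharacters

variable {F : Type*} [Field F]

/-- The character `x ↦ φ(∑ tᵢ xᵢ)` of `F^k`. -/
def dotChar (φ : AddChar F ℂ) {k : ℕ} (t : Fin k → F) : AddChar (Fin k → F) ℂ where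
  toFun x := φ (∑ i, t i * x i)
  map_zero_eq_one' := by simp
  map_add_eq_mul' x y := by
    rw [← AddChar.map_add_eq_mul, ← Finset.sum_add_distrib]
    simp only [Pi.add_apply, mul_add]

theorem dotChar_apply (φ : AddChar F ℂ) {k : ℕ} (t x : Fin k → F) :
    dotChar φ t x = φ (∑ i, t i * x i) := rfl

theorem dotChar_injective {φ : AddChar F ℂ} (hφ : φ.IsPrimitive) (k : ℕ) :
    Function.Injective (dotChar φ (k := k)) := by
  classical
  intro t s h
  funext i
  refine AddChar.to_mulShift_inj_of_isPrimitive hφ (AddChar.ext _ _ fun c => ?_)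
  have := DFunLike.congr_fun h (Pi.single i c)
  simpa [dotChar_apply, Pi.single_apply] using this

theorem exists_eq_dotChar [Fintype F] {φ : AddChar F ℂ} (hφ : φ.IsPrimitive) {k : ℕ}
    (θ : AddChar (Fin k → F) ℂ) : ∃ t, θ = dotChar φ t := by
  classical
  let : Fintype (AddChar (Fin k → F) ℂ) := Fintype.ofFinite _
  have hb : Function.Bijective (dotChar φ (k := k)) :=
    (Fintype.bijective_iff_injective_and_card _).mpr
      ⟨dotChar_injective hφ k, AddChar.card_eq.symm⟩
  obtain ⟨t, ht⟩ := hb.2 θ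
  exact ⟨t, ht.symm⟩

variable {n : ℕ}

/-- The first superdiagonal of a strictly upper triangular matrix. -/
def strictSuperdiag : strictUpper F n →+ (Fin (n - 1) → F) where
  toFun a i := a.1 (lo i) (hi i)
  map_zero' := rfl
  map_add' _ _ := rfl

theorem strictSuperdiag_mul_mul {x y : Mat F n} (hx : x.BlockTriangular id)
    (hy : y.BlockTriangular id) (a : strictUpper F n) (i : Fin (n - 1)) :
    (x * a.1 * y) (lo i) (hi i) = x (lo i) (lo i) * strictSuperdiag a i * y (hi i) (hi i) := by
  have hz : (x * a.1) (lo i) (lo i) = 0 := by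
    simpa using strictUpper_mul_mul hx Matrix.blockTriangular_one a.2 (lo i) (lo i) le_rfl
  have hz' : a.1 (hi i) (hi i) = 0 := a.2 _ _ le_rfl
  rw [superdiag_mul F (Matrix.BlockTriangular.mul hx (strictUpper_blockTriangular a)) hy,
    superdiag_mul F hx (strictUpper_blockTriangular a), hz, hz', mul_zero, add_zero, zero_mul,
    zero_add]
  rfl

theorem strictSuperdiag_borelAct (x y : borel F n) (a : strictUpper F n) (i : Fin (n - 1)) :
    strictSuperdiag (borelAct x y a) i
      = x.1.1 (lo i) (lo i) * strictSuperdiag a i * y.1.1 (hi i) (hi i) :=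
  strictSuperdiag_mul_mul x.2 y.2 a i

theorem strictSuperdiag_unipotentAct (x y : UT F n) (a : strictUpper F n) :
    strictSuperdiag (unipotentAct x y a) = strictSuperdiag a := by
  funext i
  refine (strictSuperdiag_mul_mul x.2.1 y.2.1 a i).trans ?_
  rw [x.2.2, y.2.2, one_mul, mul_one]

theorem strictSuperdiag_subOne (u : UT F n) (i : Fin (n - 1)) :
    strictSuperdiag u.subOne i = (superdiag F n u i).toAdd := by
  have hne : (lo i : Fin n) ≠ hi i := (show lo i < hi i from Nat.lt_succ_self i.val).ne
  change u.1 (lo i) (hi i) - (1 : Mat F n) (lo i) (hi i) = u.1 (lo i) (hi i)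
  rw [Matrix.one_apply_ne hne, sub_zero]

theorem strictSuperdiag_surjective : Function.Surjective (strictSuperdiag (F := F) (n := n)) := by
  intro g
  obtain ⟨u, hu⟩ := superdiag_surjective n (fun i => Multiplicative.ofAdd (g i))
  refine ⟨u.subOne, funext fun i => ?_⟩
  rw [strictSuperdiag_subOne, hu]
  rfl

theorem borel_diag_ne_zero (x : borel F n) (k : Fin n) : x.1.1 k k ≠ 0 := by
  intro hk
  have hdet : x.1.1.det ≠ 0 := ((Matrix.isUnit_iff_isUnit_det _).mp x.1.isUnit).ne_zero
  rw [Matrix.det_of_isUpperTriangular x.2] at hdet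
  exact hdet (Finset.prod_eq_zero (Finset.mem_univ k) hk)

/-- The invertible diagonal matrix with diagonal `d`. -/
def borelDiagonal (d : Fin n → Fˣ) : borel F n :=
  ⟨⟨Matrix.diagonal fun i => (d i : F), Matrix.diagonal fun i => ((d i)⁻¹ : Fˣ),
      by simp [Matrix.diagonal_mul_diagonal], by simp [Matrix.diagonal_mul_diagonal]⟩,
    Matrix.blockTriangular_diagonal _⟩

/-- The character of the strictly upper triangular matrices that is `x ↦ φ(∑ tᵢ xᵢ)` on the first
superdiagonal. These are the characters invariant under `UT_n`. -/
def linChar (φ : AddChar F ℂ) (t : Fin (n - 1) → F) : AddChar (strictUpper F n) ℂ :=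
  (dotChar φ t).compAddMonoidHom strictSuperdiag

theorem linChar_apply (φ : AddChar F ℂ) (t : Fin (n - 1) → F) (a : strictUpper F n) :
    linChar φ t a = φ (∑ i, t i * strictSuperdiag a i) := rfl

theorem linChar_injective {φ : AddChar F ℂ} (hφ : φ.IsPrimitive) :
    Function.Injective (linChar φ (n := n)) := by
  intro t s h
  refine dotChar_injective hφ _ (AddChar.ext _ _ fun x => ?_)
  obtain ⟨a, rfl⟩ := strictSuperdiag_surjective x
  exact DFunLike.congr_fun h a

theorem linChar_borelAct (φ : AddChar F ℂ) (t : Fin (n - 1) → F) (x y : borel F n)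
    (a : strictUpper F n) : linChar φ t (borelAct x y a)
      = linChar φ (fun i => t i * x.1.1 (lo i) (lo i) * y.1.1 (hi i) (hi i)) a := by
  simp only [linChar_apply, strictSuperdiag_borelAct]
  congr 1
  refine Finset.sum_congr rfl fun i _ => ?_
  ring

theorem linChar_unipotentAct (φ : AddChar F ℂ) (t : Fin (n - 1) → F) (x y : UT F n)
    (a : strictUpper F n) : linChar φ t (unipotentAct x y a) = linChar φ t a := by
  rw [linChar_apply, strictSuperdiag_unipotentAct, linChar_apply]

/-- The two-sided orbit of a linear character under the triangular group: the coefficients can be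
rescaled independently, by diagonal matrices, and nothing else happens. -/
theorem mem_borel_orbit_linChar (φ : AddChar F ℂ) (t : Fin (n - 1) → F)
    (μ : AddChar (strictUpper F n) ℂ) :
    (∃ x y : borel F n, ∀ a, μ a = linChar φ t (borelAct x y a))
      ↔ ∃ s, (∀ i, s i = 0 ↔ t i = 0) ∧ linChar φ s = μ := by
  classical
  constructor
  · rintro ⟨x, y, h⟩
    refine ⟨fun i => t i * x.1.1 (lo i) (lo i) * y.1.1 (hi i) (hi i), fun i => ?_, ?_⟩
    · simp [borel_diag_ne_zero]
    · refine AddChar.ext _ _ fun a => ?_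
      rw [h, linChar_borelAct]
  · rintro ⟨s, hs, rfl⟩
    -- the diagonal matrix that rescales the row `i` by `s i / t i`
    have hne : ∀ i, (if t i = 0 then 1 else s i / t i) ≠ 0 := by
      intro i
      split_ifs with h
      · exact one_ne_zero
      · exact div_ne_zero (fun h' => h ((hs i).mp h')) h
    refine ⟨borelDiagonal fun k => if h : k.val < n - 1 then Units.mk0 _ (hne ⟨k, h⟩) else 1, 1,
      fun a => ?_⟩
    rw [linChar_borelAct]
    congr 2
    funext i
    have h1 : (1 : borel F n).1.1 (hi i) (hi i) = 1 := Matrix.one_apply_eq _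
    have h2 : (borelDiagonal (fun k => if h : k.val < n - 1 then Units.mk0 _ (hne ⟨k, h⟩) else 1)
        : borel F n).1.1 (lo i) (lo i) = if t i = 0 then 1 else s i / t i := by
      change Matrix.diagonal _ _ _ = _
      rw [Matrix.diagonal_apply_eq]
      exact congrArg Units.val (dif_pos (show (lo i).val < n - 1 from i.2))
    rw [h1, h2, mul_one]
    split_ifs with h
    · rw [h, zero_mul, (hs i).mpr h]
    · rw [mul_div_cancel₀ _ h]

theorem UT.subOne_bijective : Function.Bijective (UT.subOne (F := F) (n := n)) := by
  constructor
  · intro u v h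
    exact Subtype.ext (sub_left_injective (congrArg Subtype.val h))
  · intro a
    refine ⟨⟨a.1 + 1, ?_, fun i => ?_⟩, Subtype.ext (add_sub_cancel_right a.1 1)⟩
    · exact (strictUpper_blockTriangular a).add Matrix.blockTriangular_one
    · rw [Matrix.add_apply, a.2 i i le_rfl, Matrix.one_apply_eq, zero_add]

/-! ### Supercharacters with linear constituents -/

variable [Fintype F]

open Classical in
/-- For a linear `θ` both `UT_n`-orbits are singletons, and the sum over the orbit under `B_n` factors
into the sums `∑_{s ≠ 0} φ(s x) = reg(x) - 1`, one for each superdiagonal position in the support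
of `t`. -/
theorem utSuperchar_linChar {φ : AddChar F ℂ} (hφ : φ.IsPrimitive) (t : Fin (n - 1) → F)
    (u : UT F n) : utSuperchar (linChar φ t) u
      = ∏ i, if t i = 0 then 1
        else (reg (Multiplicative F) - scf.one _ : scf (trivialCl (Multiplicative F))).1
          (superdiag F n u i) := by
  have hcard : ∀ P : AddChar (strictUpper F n) ℂ → Prop, (∀ μ, P μ ↔ μ = linChar φ t) →
      (Nat.card {μ // P μ} : ℂ) = 1 := by
    intro P hP
    have : Nat.card {μ // P μ} = 1 := by
      simp only [hP, Nat.card_unique]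
    rw [this, Nat.cast_one]
  have h1 : (Nat.card {μ : AddChar (strictUpper F n) ℂ //
      ∃ y : UT F n, ∀ a, μ a = linChar φ t (unipotentAct 1 y a)} : ℂ) = 1 := by
    refine hcard _ fun μ => ?_
    simp only [linChar_unipotentAct, exists_const]
    exact DFunLike.ext_iff.symm
  have h2 : (Nat.card {μ : AddChar (strictUpper F n) ℂ //
      ∃ x y : UT F n, ∀ a, μ a = linChar φ t (unipotentAct x y a)} : ℂ) = 1 := by
    refine hcard _ fun μ => ?_
    simp only [linChar_unipotentAct, exists_const]
    exact DFunLike.ext_iff.symm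
  rw [utSuperchar, h1, h2, div_one, one_mul]
  simp only [mem_borel_orbit_linChar]
  rw [← Finset.sum_filter]
  have h3 : (Finset.univ.filter fun μ : AddChar (strictUpper F n) ℂ =>
      ∃ s, (∀ i, s i = 0 ↔ t i = 0) ∧ linChar φ s = μ)
      = (Finset.univ.filter fun s : Fin (n - 1) → F => ∀ i, s i = 0 ↔ t i = 0).image
        (linChar φ) := by
    ext μ
    simp
  rw [h3, Finset.sum_image (linChar_injective hφ).injOn, Finset.sum_filter]
  have h4 : ∀ s : Fin (n - 1) → F, (if ∀ i, s i = 0 ↔ t i = 0 then linChar φ s u.subOne else 0)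
      = ∏ i, if s i = 0 ↔ t i = 0 then φ (s i * (superdiag F n u i).toAdd) else 0 := by
    intro s
    rw [linChar_apply]
    split_ifs with h
    · simp only [h, strictSuperdiag_subOne, if_true]
      exact map_prod φ.toMonoidHom (fun i => Multiplicative.ofAdd (s i * (superdiag F n u i).toAdd))
        Finset.univ
    · push Not at h
      obtain ⟨i, hi⟩ := h
      refine (Finset.prod_eq_zero (Finset.mem_univ i) (if_neg ?_)).symm
      tauto
  simp only [h4]
  have h5 := Finset.prod_univ_sum (fun _ : Fin (n - 1) => (Finset.univ : Finset F))
    (fun i c => if c = 0 ↔ t i = 0 then φ (c * (superdiag F n u i).toAdd) else 0)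
  rw [Fintype.piFinset_univ] at h5
  rw [← h5]
  refine Finset.prod_congr rfl fun i _ => ?_
  by_cases ht : t i = 0
  · simp [ht]
  · simp only [ht, iff_false, if_false]
    have h6 : ∀ c : F, (if ¬ c = 0 then φ (c * (superdiag F n u i).toAdd) else 0)
        = φ (c * (superdiag F n u i).toAdd) - if c = 0 then 1 else 0 := by
      intro c
      by_cases hc : c = 0 <;> simp [hc]
    simp only [h6, Finset.sum_sub_distrib, Finset.sum_ite_eq', Finset.mem_univ, if_true]
    rw [AddChar.sum_mulShift _ hφ]
    change _ = (if superdiag F n u i = 1 then (Fintype.card (Multiplicative F) : ℂ) else 0) - 1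
    simp only [Fintype.card_multiplicative, toAdd_eq_zero]
    split_ifs <;> simp

/-- Orthogonality of the characters of the strictly upper triangular matrices, transported to
`UT_n`. -/
theorem sum_mul_conj_subOne (ν : AddChar (strictUpper F n) ℂ)
    (P : AddChar (strictUpper F n) ℂ → Prop) [DecidablePred P] (c : ℂ) :
    innerProd (fun u : UT F n => c * ∑ μ : AddChar (strictUpper F n) ℂ,
      if P μ then μ u.subOne else 0) (fun u => ν u.subOne) = c * if P ν then 1 else 0 := by
  classical
  let : Fintype (strictUpper F n) := Fintype.ofFinite _
  have hcard : Fintype.card (strictUpper F n) = Fintype.card (UT F n) :=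
    (Fintype.card_of_bijective UT.subOne_bijective).symm
  have horth : ∀ μ : AddChar (strictUpper F n) ℂ,
      ∑ u : UT F n, μ u.subOne * starRingEnd ℂ (ν u.subOne)
        = if μ = ν then (Fintype.card (UT F n) : ℂ) else 0 := by
    intro μ
    rw [UT.subOne_bijective.sum_comp (fun a => μ a * starRingEnd ℂ (ν a))]
    have : ∀ a, μ a * starRingEnd ℂ (ν a) = (μ - ν) a := by
      intro a
      rw [AddChar.sub_apply, AddChar.map_neg_eq_conj]
    simp only [this]
    rw [AddChar.sum_eq_ite]
    simp only [sub_eq_zero, hcard]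
  have h1 : ∀ u : UT F n, (c * ∑ μ : AddChar (strictUpper F n) ℂ,
      if P μ then μ u.subOne else 0) * starRingEnd ℂ (ν u.subOne)
      = c * ∑ μ : AddChar (strictUpper F n) ℂ,
        if P μ then μ u.subOne * starRingEnd ℂ (ν u.subOne) else 0 := by
    intro u
    rw [mul_assoc, Finset.sum_mul]
    simp only [ite_mul, zero_mul]
  have h2 : ∀ μ : AddChar (strictUpper F n) ℂ,
      (∑ u : UT F n, if P μ then μ u.subOne * starRingEnd ℂ (ν u.subOne) else 0)
      = if μ = ν then (if P ν then (Fintype.card (UT F n) : ℂ) else 0) else 0 := by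
    intro μ
    by_cases hP : P μ
    · simp only [hP, if_true, horth]
      split_ifs with h3 h4
      · rfl
      · exact absurd (h3 ▸ hP) h4
      · rfl
    · simp only [hP, if_false, Finset.sum_const_zero]
      split_ifs with h3 h4
      · exact absurd (h3 ▸ h4) hP
      · rfl
      · rfl
  rw [innerProd]
  simp only [h1, ← Finset.mul_sum]
  rw [Finset.sum_comm]
  simp only [h2, Finset.sum_ite_eq', Finset.mem_univ, if_true]
  rw [mul_left_comm, mul_ite, mul_zero,
    inv_mul_cancel₀ (Nat.cast_ne_zero.mpr Fintype.card_ne_zero)]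

open Classical in
/-- The multiplicity of the function `u ↦ ν(u - 1)` in a supercharacter is nonzero exactly if `ν` lies in
the orbit of `θ`. -/
theorem innerProd_utSuperchar (θ ν : AddChar (strictUpper F n) ℂ) :
    innerProd (utSuperchar θ) (fun u => ν u.subOne)
      = (Nat.card {μ : AddChar (strictUpper F n) ℂ //
          ∃ y : UT F n, ∀ a, μ a = θ (unipotentAct 1 y a)} : ℂ)
        / (Nat.card {μ : AddChar (strictUpper F n) ℂ //
          ∃ x y : UT F n, ∀ a, μ a = θ (unipotentAct x y a)} : ℂ)
        * if ∃ x y : borel F n, ∀ a, ν a = θ (borelAct x y a) then 1 else 0 :=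
  sum_mul_conj_subOne ν (fun μ => ∃ x y : borel F n, ∀ a, μ a = θ (borelAct x y a)) _

/-- The linear characters of `UT_n` are the inflations of the characters of the superdiagonal. -/
theorem exists_linChar_of_hom {φ : AddChar F ℂ} (hφ : φ.IsPrimitive) (ρ : UT F n →* ℂˣ) :
    ∃ t, ∀ u, (ρ u : ℂ) = linChar φ t u.subOne := by
  let e := MulEquiv.ofBijective _ (abelianization_lift_superdiag_bijective (F := F) (n := n))
  let σ : (Fin (n - 1) → Multiplicative F) →* ℂˣ := (Abelianization.lift ρ).comp e.symm.toMonoidHom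
  have hσ : ∀ u, σ (superdiag F n u) = ρ u := by
    intro u
    have : e.symm (superdiag F n u) = Abelianization.of u := by
      rw [MulEquiv.symm_apply_eq]
      rfl
    change Abelianization.lift ρ (e.symm (superdiag F n u)) = ρ u
    rw [this, Abelianization.lift_apply_of]
  let θ : AddChar (Fin (n - 1) → F) ℂ :=
    { toFun := fun x => σ fun i => Multiplicative.ofAdd (x i)
      map_zero_eq_one' := by
        exact congrArg Units.val (map_one σ)
      map_add_eq_mul' := fun x y => congrArg Units.val
        (map_mul σ (fun i => Multiplicative.ofAdd (x i)) (fun i => Multiplicative.ofAdd (y i))) }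
  obtain ⟨t, ht⟩ := exists_eq_dotChar hφ θ
  refine ⟨t, fun u => ?_⟩
  change _ = dotChar φ t (strictSuperdiag u.subOne)
  rw [← ht, ← hσ]
  refine congrArg (fun g => (σ g : ℂ)) (funext fun i => ?_)
  rw [strictSuperdiag_subOne]
  rfl

/-- The orbit of `θ` under the triangular group contains a linear character only if `θ` is linear itself,
as these orbits consist of linear characters only. -/
theorem containsLinear_utSuperchar_iff {φ : AddChar F ℂ} (hφ : φ.IsPrimitive)
    (θ : AddChar (strictUpper F n) ℂ) :
    ContainsLinear F (utSuperchar θ) ↔ ∃ t, θ = linChar φ t := by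
  classical
  constructor
  · rintro ⟨ρ, hρ⟩
    obtain ⟨t, ht⟩ := exists_linChar_of_hom hφ ρ
    simp only [ht] at hρ
    rw [innerProd_utSuperchar] at hρ
    have hmem : ∃ x y : borel F n, ∀ a, linChar φ t a = θ (borelAct x y a) := by
      by_contra hc
      rw [if_neg hc, mul_zero] at hρ
      exact hρ rfl
    -- `B_n` permutes the characters of the superdiagonal, so `θ` is one as well
    obtain ⟨x, y, h⟩ := hmem
    refine ⟨fun i => t i * (x⁻¹).1.1 (lo i) (lo i) * (y⁻¹).1.1 (hi i) (hi i),
      AddChar.ext _ _ fun a => ?_⟩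
    rw [← linChar_borelAct, h]
    congr 1
    apply Subtype.ext
    simp [borelAct, mul_assoc]
  · rintro ⟨t, rfl⟩
    let f : UT F n →* ℂ :=
      { toFun := fun u => linChar φ t u.subOne
        map_one' := by
          have : (1 : UT F n).subOne = 0 := Subtype.ext (sub_self (1 : Mat F n))
          rw [this, AddChar.map_zero_eq_one]
        map_mul' := fun u v => by
          rw [← AddChar.map_add_eq_mul, linChar_apply, linChar_apply]
          congr 1
          refine Finset.sum_congr rfl fun i _ => ?_
          rw [map_add, Pi.add_apply, strictSuperdiag_subOne, strictSuperdiag_subOne,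
            strictSuperdiag_subOne, map_mul]
          rfl }
    refine ⟨f.toHomUnits, ?_⟩
    change innerProd (utSuperchar (linChar φ t)) (fun u => linChar φ t u.subOne) ≠ 0
    have hself : ∃ x y : borel F n, ∀ a, linChar φ t a = linChar φ t (borelAct x y a) := by
      refine ⟨1, 1, fun a => congrArg _ (Subtype.ext ?_)⟩
      simp [borelAct]
    rw [innerProd_utSuperchar, if_pos hself, mul_one]
    refine div_ne_zero (Nat.cast_ne_zero.mpr ?_) (Nat.cast_ne_zero.mpr ?_)
    · rw [Nat.card_ne_zero]
      exact ⟨⟨⟨linChar φ t, 1, fun a => (linChar_unipotentAct φ t 1 1 a).symm⟩⟩, inferInstance⟩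
    · rw [Nat.card_ne_zero]
      exact ⟨⟨⟨linChar φ t, 1, 1, fun a => (linChar_unipotentAct φ t 1 1 a).symm⟩⟩, inferInstance⟩

/-- The supercharacter of `G^{n-1}` with factor `reg - 1` in the positions of a set inflates to the
supercharacter of the linear character supported on this set. -/
theorem image_infl_powCh (n : ℕ) :
    (fun ψ => (infl F n ψ).1) '' powCh (trivialCh (Multiplicative F)) (n - 1)
      = {χ | χ ∈ utCh F n ∧ ContainsLinear F χ} := by
  classical
  obtain ⟨φ, hφ1⟩ := AddChar.exists_apply_ne_zero.mpr (one_ne_zero (α := F))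
  have hφ : φ.IsPrimitive := AddChar.IsPrimitive.of_ne_one
    (AddChar.ne_one_iff.mpr ⟨1, hφ1⟩)
  ext χ
  constructor
  · rintro ⟨ψ, ⟨κ, hκ, hψ⟩, rfl⟩
    let t : Fin (n - 1) → F := fun i => if κ i = scf.one _ then 0 else 1
    have h : (infl F n ψ).1 = utSuperchar (linChar φ t) := by
      funext u
      rw [utSuperchar_linChar hφ]
      refine (hψ _).trans (Finset.prod_congr rfl fun i _ => ?_)
      by_cases hi : κ i = scf.one _
      · simp only [t, hi, if_true]
        rfl
      · simp only [t, hi, if_false, one_ne_zero]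
        rw [(hκ i).resolve_left hi]
    change (infl F n ψ).1 ∈ _
    rw [h]
    exact ⟨⟨_, rfl⟩, (containsLinear_utSuperchar_iff hφ _).mpr ⟨t, rfl⟩⟩
  · rintro ⟨⟨θ, rfl⟩, h⟩
    obtain ⟨t, rfl⟩ := (containsLinear_utSuperchar_iff hφ θ).mp h
    let κ : Fin (n - 1) → scf (trivialCl (Multiplicative F)) := fun i =>
      if t i = 0 then scf.one _ else reg (Multiplicative F) - scf.one _
    refine ⟨⟨fun g => ∏ i, (κ i).1 (g i), fun g g' hg => ?_⟩, ⟨κ, fun i => ?_, fun g => rfl⟩, ?_⟩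
    · exact Finset.prod_congr rfl fun i _ => (κ i).2 _ _ (hg i)
    · by_cases hi : t i = 0
      · exact Or.inl (if_pos hi)
      · exact Or.inr (if_neg hi)
    · funext u
      rw [utSuperchar_linChar hφ]
      change ∏ i, (κ i).1 (superdiag F n u i) = _
      refine Finset.prod_congr rfl fun i _ => ?_
      by_cases hi : t i = 0
      · simp only [κ, hi, if_true]
        rfl
      · simp only [κ, hi, if_false]

end Supercharacters

end TowerHopf

end

theorem proposition4p5 (F : Type*) [Field F] [Fintype F] :
    -- both sides, with the operations defined above, are Hopf algebras
    TowerHopf.IsHopf (TowerHopf.HOne F) ∧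
    TowerHopf.IsHopf (TowerHopf.ScfUT F) ∧
    -- the superdiagonal induces an isomorphism of the abelianization of `UT_n` with `G^{n-1}`
    (∀ n, Function.Bijective (Abelianization.lift (TowerHopf.superdiag F n))) ∧
    -- inflation gives an injective morphism of Hopf algebras
    (∃ Φ : TowerHopf.HOne F →ₐc[ℂ] TowerHopf.ScfUT F,
      (∀ n ψ, Φ (TowerHopf.TowerAlg.incl _ _ _ n ψ)
        = TowerHopf.ScfUT.incl F n (TowerHopf.infl F n ψ)) ∧
      Function.Injective Φ) ∧
    -- the images of the supercharacters are the supercharacters that contain linear characters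
    (∀ n, (fun ψ => (TowerHopf.infl F n ψ).1) ''
          TowerHopf.powCh (TowerHopf.trivialCh (Multiplicative F)) (n - 1)
        = {χ | χ ∈ TowerHopf.utCh F n ∧ TowerHopf.ContainsLinear F χ}) :=
  ⟨TowerHopf.HOne.isHopf, TowerHopf.ScfUT.isHopf,
    fun _ => TowerHopf.abelianization_lift_superdiag_bijective,
    ⟨TowerHopf.HOne.inflationHom F, fun n ψ => TowerHopf.HOne.inflation_incl n ψ,
      TowerHopf.HOne.inflation_injective⟩, TowerHopf.image_infl_powCh⟩
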